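/- Let $F(X)=X^d+a_1X^{d-1}+\cdots+a_d\in\mathbb Z[X]$ be irreducible, and let $\mathbb Z[\alpha]=\mathbb Z[X]/(F)$, with field of fractions $\mathbb Q(\alpha)$ having $r_1$ real embeddings and $r_2$ pairs of complex conjugate embeddings, $d=r_1+2r_2$. Order the $d$ embeddings $x\mapsto x^{(j)}$ of $\mathbb Q(\alpha)$ into $\mathbb C$ so that the first $r_1$ are real and the others come in $r_2$ adjacent conjugate pairs. Let $C^+_{r_1,r_2}\subset\mathbb C^d$ be the set of $\xi=(\xi^{(1)},\dots,\xi^{(d)})$ whose first $r_1$ coordinates are real and positive and whose remaining coordinates form $r_2$ adjacent pairs of complex conjugates. The narrow ideal classes are the invertible fractional ideals of $\mathbb Z[\alpha]$ modulo multiplication by elements of $\mathbb Q(\alpha)^\times$ that are positive in every real embedding. Index them by $l$, with $l=1$ the trivial class; fix an integral ideal $I_l$ in each class and a $\mathbb Z$-basis $\beta_{l1},\dots,\beta_{ld}$ of $I_l$, and put $\mathfrak B_l=(\beta_{li}^{(j)})_{1\le i,j\le d}$. Assume that $I_1=\mathbb Z[\alpha]$ with the basis $\alpha^{d-1},\dots,\alpha,1$,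 and that $\det\mathfrak B_l/\det\mathfrak B_1>0$ for all $l$. Let $\Gamma=\mathrm{SL}(d,\mathbb Z)$, let $U\subset\Gamma$ be the subgroup of the matrices that differ from the identity matrix at most in the entries of the last column above the diagonal, and let $\Gamma_l=\Gamma\cap\{\mathfrak B_l\,\mathrm{diag}(\xi)\,\mathfrak B_l^{-1}:\xi\in C^+_{r_1,r_2}\}$. A root is a pair of an integer $m>0$ and a residue class $\mu \pmod m$ with $F(\mu)\equiv 0\pmod m$. A basis matrix of this root is a $d\times d$ integer matrix of the form $$R=\begin{pmatrix}1&\cdots&0&-\mu^{d-1}\\ \vdots&\ddots&\vdots&\vdots\\ 0&\cdots&1&-\mu\\ 0&\cdots&0&m\end{pmatrix},$$ where each of the residue classes $\mu^{d-1},\dots,\mu \pmod m$ may be represented by any integer in it. The root corresponds to the ideal of $\mathbb Z[\alpha]$ which has the entries of $R\,(\alpha^{d-1},\dots,\alpha,1)^{t}$ as a $\mathbb Z$-basis (this does not depend on the choice of $R$). **(1)** Let a root $\mu\pmod m$ correspond to an invertible ideal. Then there are a unique $l$ and a unique double coset $U\gamma\Gamma_l\in U\backslash\Gamma/\Gamma_l$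 such that $$R\,\mathfrak B_1=\gamma\,\mathfrak B_l\,\mathrm{diag}(\xi^{(1)},\dots,\xi^{(d)})$$ for some $\gamma$ in the double coset, some basis matrix $R$ of the root and some $\xi\in C^+_{r_1,r_2}$. Moreover, for this $l$ and this double coset, every basis matrix $R$ of the root occurs with some $\gamma$ in the double coset and some $\xi\in C_{r_1,r_2}^+$, and every $\gamma$ in the double coset occurs with some $R$ and some $\xi\in C_{r_1,r_2}^+$. **(2)** Conversely, let $d\ge 2$, let $l$ and a double coset $U\gamma\Gamma_l\in U\backslash\Gamma/\Gamma_l$ be given, and suppose that for some representative $\gamma$ and some $\xi\in C^+_{r_1,r_2}$ $$\gamma\,\mathfrak B_l\,\mathrm{diag}(\xi^{(1)},\dots,\xi^{(d)})=\begin{pmatrix}1&\cdots&0&*\\ \vdots&\ddots&\vdots&\vdots\\ 0&\cdots&1&*\\ 0&\cdots&0&*\end{pmatrix}\mathfrak B_1$$ with arbitrary complex numbers $*$. Then necessarily $\gamma\,\mathfrak B_l\,\mathrm{diag}(\xi^{(1)},\dots,\xi^{(d)})=R\,\mathfrak B_1$, where $R$ is a basis matrix of a root $\mu\pmod m$ that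 corresponds to an invertible ideal. This root is unique: it is the only root with a basis matrix $R'$ satisfying $\gamma'\,\mathfrak B_l\,\mathrm{diag}(\xi')=R'\,\mathfrak B_1$ for some $\gamma'\in U\gamma\Gamma_l$ and some $\xi'\in C^+_{r_1,r_2}$. -/

import Mathlib

open Polynomial
open scoped nonZeroDivisors

noncomputable section

/-! ### Roots of the polynomial congruence and their ideals -/

/-- A root of the polynomial congruence `F(μ) ≡ 0 (mod m)`: a positive modulus `m` together with
a residue class `μ` modulo `m` at which `F` vanishes. -/
structure CongruenceRoot (F : ℤ[X]) where
  /-- the modulus `m` -/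
  modulus : ℕ
  modulus_pos : 0 < modulus
  /-- the residue class `μ` modulo `m` -/
  residue : ZMod modulus
  isRoot : F.eval₂ (Int.castRingHom (ZMod modulus)) residue = 0

/-- All columns of the matrix but the last one agree with those of the identity matrix; the
entries of the last column are arbitrary. -/
def HasCyclicShape {d : ℕ} {A : Type*} [Zero A] [One A] (M : Matrix (Fin d) (Fin d) A) : Prop :=
  ∀ i j : Fin d, j.val + 1 < d → M i j = if i = j then 1 else 0

/-- The integer matrix `R` is the basis matrix attached to the root `μ` modulo `m`:
its last column is `(-μ^(d-1), …, -μ, m)`, where each power `μ^k`, which is only a residue class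
modulo `m`, is represented by an arbitrary integer, and its other columns are those of the
identity matrix. (Rows are numbered from `0`, so the entry in row `i` is `-μ^(d-1-i)`.) -/
def CongruenceRoot.IsBasisMatrix {F : ℤ[X]} (r : CongruenceRoot F) {d : ℕ}
    (R : Matrix (Fin d) (Fin d) ℤ) : Prop :=
  HasCyclicShape R ∧
    (∀ i j : Fin d, j.val + 1 = d → i.val + 1 < d →
      (R i j : ZMod r.modulus) = -r.residue ^ (d - 1 - i.val)) ∧
    (∀ j : Fin d, j.val + 1 = d → R j j = (r.modulus : ℤ))

/-- The ideal `I` of `ℤ[α] = ℤ[X]/(F)` corresponds to the root `μ` modulo `m`: its underlying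
lattice is generated by the entries of `R · (α^(d-1), …, α, 1)ᵗ`, with `R` a basis matrix attached
to the root. (These entries are linearly independent, since `det R = m ≠ 0`.) -/
def CongruenceRoot.CorrespondsTo {F : ℤ[X]} (r : CongruenceRoot F)
    (I : Ideal (AdjoinRoot F)) : Prop :=
  ∃ R : Matrix (Fin F.natDegree) (Fin F.natDegree) ℤ, r.IsBasisMatrix R ∧
    Submodule.toAddSubgroup I = AddSubgroup.closure (Set.range fun i : Fin F.natDegree =>
      ∑ j : Fin F.natDegree, R i j • AdjoinRoot.root F ^ (F.natDegree - 1 - j.val))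

/-- The root corresponds to an invertible ideal of `ℤ[α]`; here `K` is the field of fractions
of `ℤ[α]`. -/
def CongruenceRoot.HasInvertibleIdeal {F : ℤ[X]} (r : CongruenceRoot F) (K : Type*) [Field K]
    [Algebra (AdjoinRoot F) K] : Prop :=
  ∃ I : Ideal (AdjoinRoot F), r.CorrespondsTo I ∧
    IsUnit (I : FractionalIdeal (AdjoinRoot F)⁰ K)

/-! ### Narrow ideal classes -/

/-- The totally positive elements of `K`: those that are positive in every real embedding. -/
def totallyPositive (K : Type*) [Field K] : Subgroup Kˣ where
  carrier := {x | ∀ φ : K →+* ℝ, 0 < φ x}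
  mul_mem' := by
    intro a b ha hb φ
    rw [Units.val_mul, map_mul]
    exact mul_pos (ha φ) (hb φ)
  one_mem' := by
    intro φ
    simp
  inv_mem' := by
    intro a ha φ
    rw [Units.val_inv_eq_inv_val, map_inv₀]
    exact inv_pos.mpr (ha φ)

/-- The narrow class group of `O`: invertible fractional ideals modulo the principal ones that
are generated by a totally positive element. -/
abbrev NarrowClassGroup (O : Type*) [CommRing O] (K : Type*) [Field K] [Algebra O K]
    [IsFractionRing O K] : Type _ :=
  (FractionalIdeal O⁰ K)ˣ ⧸ (totallyPositive K).map (toPrincipalIdeal O K)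

/-! ### The signature space -/

/-- The signature space `C_{r₁,r₂} ⊆ ℂ^d`: the first `r₁` coordinates are real, the remaining ones
are arranged in `r₂` adjacent pairs of complex conjugates. -/
def signatureSpace (d r₁ r₂ : ℕ) : Set (Fin d → ℂ) :=
  {ξ | (∀ j : Fin d, j.val < r₁ → (ξ j).im = 0) ∧
    ∀ j j' : Fin d, ∀ k : ℕ, k < r₂ → j.val = r₁ + 2 * k → j'.val = r₁ + 2 * k + 1 →
      ξ j' = starRingEnd ℂ (ξ j)}

/-- The part `C_{r₁,r₂}^+` of the signature space where the real coordinates are positive. -/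
def signatureSpacePos (d r₁ r₂ : ℕ) : Set (Fin d → ℂ) :=
  {ξ | ξ ∈ signatureSpace d r₁ r₂ ∧ ∀ j : Fin d, j.val < r₁ → 0 < (ξ j).re}

/-- `C_{r₁,r₂}^+` for the signature of the number field `K`. -/
abbrev fieldSignaturePos (d : ℕ) (K : Type*) [Field K] [NumberField K] : Set (Fin d → ℂ) :=
  signatureSpacePos d (NumberField.InfinitePlace.nrRealPlaces K)
    (NumberField.InfinitePlace.nrComplexPlaces K)

/-! ### Matrices -/

/-- An integer matrix viewed as a complex matrix. -/
abbrev toComplex {d : ℕ} (M : Matrix (Fin d) (Fin d) ℤ) : Matrix (Fin d) (Fin d) ℂ :=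
  M.map (Int.cast : ℤ → ℂ)

/-- The matrix `𝔅` whose rows are the images of the entries of `b` under the `d` embeddings `σ`. -/
def embeddingMatrix {d : ℕ} {O K : Type*} [CommRing O] [Field K] [Algebra O K]
    (σ : Fin d → (K →+* ℂ)) (b : Fin d → O) : Matrix (Fin d) (Fin d) ℂ :=
  Matrix.of fun i j => σ j (algebraMap O K (b i))

/-- The group `U` of matrices in `SL(d, ℤ)` that agree with the identity matrix except possibly in
the entries of the last column above the diagonal. -/
def cyclicUnipotent (d : ℕ) : Set (Matrix.SpecialLinearGroup (Fin d) ℤ) :=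
  {u | HasCyclicShape (u : Matrix (Fin d) (Fin d) ℤ) ∧
    ∀ j : Fin d, (u : Matrix (Fin d) (Fin d) ℤ) j j = 1}

/-- The group `SL(d, ℤ) ∩ {𝔅 diag(ξ) 𝔅⁻¹ : ξ ∈ C}`, where `C` is a set of diagonals. -/
def diagonalStabilizer {d : ℕ} (C : Set (Fin d → ℂ)) (B : Matrix (Fin d) (Fin d) ℂ) :
    Set (Matrix.SpecialLinearGroup (Fin d) ℤ) :=
  {γ | ∃ ξ ∈ C, toComplex (γ : Matrix (Fin d) (Fin d) ℤ) = B * Matrix.diagonal ξ * B⁻¹}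

/-- The set `U \ SL(d, ℤ) / Γ'` of double cosets `U γ Γ'`. -/
def cyclicDoubleCosets {d : ℕ} (Γ' : Set (Matrix.SpecialLinearGroup (Fin d) ℤ)) :
    Set (Set (Matrix.SpecialLinearGroup (Fin d) ℤ)) :=
  Set.range fun γ => DoubleCoset.doubleCoset γ (cyclicUnipotent d) Γ'

end

/-!
Multiplication by `x ∈ K` acts on the vector of the `d` embeddings as the diagonal matrix of the
conjugates of `x`. An equation `R 𝔅₁ = γ 𝔅_l diag(ξ)` with integer matrices `R`, `γ` therefore
relates two families `e = R (α^(d-1), …, 1)ᵗ` and `c = γ β_l` in `ℤ[α]`: the ratios `e_i / c_i` all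
agree, their common value `x ∈ K` has the conjugates `ξ`, and `x` is totally positive when `ξ` lies
in `C^+`. The lattice spanned by `e` is then `x I_l`.

Given a root with invertible ideal `J`, let `l` be the narrow class of `J`. Then `J = x I_l` with `x`
totally positive, and comparing `ℤ`-bases gives an equation with `γ` invertible over `ℤ`
(`exists_embeddingMatrix_eq_of_narrowClass_eq`); the determinant is `1` since all other determinants
in the equation have ratios of positive sign (`exists_pos_det_eq`). Any equation for the same root
determines the class `l` (`narrowClass_eq_of_embeddingMatrix_eq`). The basis matrices of one root
form a single `U`-orbit, and for a fixed `R` the choice of `γ` is unique up to `Γ_l`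
(`mem_doubleCoset_of_equation`), so that the double coset is unique too.

Conversely, let `γ 𝔅_l diag(ξ) = S 𝔅₁` with `S` of cyclic shape and corner entry `T`, and `c = γ β_l`.
The last row says `c_last^(j) ξ^(j) = T` for every `j`. As `α^k c_last ∈ I_l` is an integer combination
of `c`, there is an integer matrix `N` with `N S 𝔅₁ = T 𝔅₁`, hence `N S = T`, and this makes `S`
integral (`exists_root_of_equation`). The lattice `J` of `S` is the ideal `x I_l`, with
`J ∩ ℤ = Tℤ`; modulo `J` the element `α` is congruent to an integer `μ`, and so `F(μ) ≡ F(α) = 0` and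
the entries of the last column are the negated powers of `μ` modulo `T` (`exists_congruenceRoot`). Two
cyclic integer matrices that both belong to `γ` are equal (`eq_of_mul_diagonal`), whence the root is
unique.
-/

/-! ### The signature space and total positivity -/

theorem mul_mem_signatureSpacePos {d r₁ r₂ : ℕ} {ξ η : Fin d → ℂ}
    (hξ : ξ ∈ signatureSpacePos d r₁ r₂) (hη : η ∈ signatureSpacePos d r₁ r₂) :
    ξ * η ∈ signatureSpacePos d r₁ r₂ := by
  refine ⟨⟨fun j hj => ?_, fun j j' k hk hj hj' => ?_⟩, fun j hj => ?_⟩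
  · simp [Complex.mul_im, hξ.1.1 j hj, hη.1.1 j hj]
  · simp [hξ.1.2 j j' k hk hj hj', hη.1.2 j j' k hk hj hj']
  · simpa [Complex.mul_re, hξ.1.1 j hj] using mul_pos (hξ.2 j hj) (hη.2 j hj)

theorem inv_mem_signatureSpacePos {d r₁ r₂ : ℕ} {ξ : Fin d → ℂ}
    (hξ : ξ ∈ signatureSpacePos d r₁ r₂) : ξ⁻¹ ∈ signatureSpacePos d r₁ r₂ := by
  refine ⟨⟨fun j hj => ?_, fun j j' k hk hj hj' => ?_⟩, fun j hj => ?_⟩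
  · simp [Complex.inv_im, hξ.1.1 j hj]
  · simp [hξ.1.2 j j' k hk hj hj']
  · have h := hξ.2 j hj
    rw [Pi.inv_apply, Complex.inv_re]
    refine div_pos h (Complex.normSq_pos.2 fun h0 => ?_)
    simp [h0] at h

theorem one_mem_signatureSpacePos (d r₁ r₂ : ℕ) : (1 : Fin d → ℂ) ∈ signatureSpacePos d r₁ r₂ := by
  refine ⟨⟨fun j hj => ?_, fun j j' k hk hj hj' => ?_⟩, fun j hj => ?_⟩ <;> simp

/-- The coordinates in a conjugate pair contribute `|ξ|²` to the product. -/
theorem exists_pos_prod_eq_of_mem_signatureSpacePos {d r₁ r₂ : ℕ} (hd : r₁ + 2 * r₂ = d)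
    {ξ : Fin d → ℂ} (hξ : ξ ∈ signatureSpacePos d r₁ r₂) (h0 : ∀ j, ξ j ≠ 0) :
    ∃ c : ℝ, 0 < c ∧ ∏ j, ξ j = c := by
  have hmul : ∀ n (f : ℕ → ℂ), (∀ i < n, ∃ c : ℝ, 0 < c ∧ f i = c) →
      ∃ c : ℝ, 0 < c ∧ ∏ i ∈ Finset.range n, f i = c := by
    intro n f hf
    induction n with
    | zero => exact ⟨1, one_pos, by simp⟩
    | succ n ih =>
      obtain ⟨a, ha, ha'⟩ := ih fun i hi => hf i (by omega)
      obtain ⟨b, hb, hb'⟩ := hf n (by omega)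
      exact ⟨a * b, mul_pos ha hb, by rw [Finset.prod_range_succ, ha', hb']; push_cast; rfl⟩
  have hpair : ∀ n (f : ℕ → ℂ),
      ∏ i ∈ Finset.range (2 * n), f i = ∏ i ∈ Finset.range n, f (2 * i) * f (2 * i + 1) := by
    intro n f
    induction n with
    | zero => simp
    | succ n ih =>
      rw [Nat.mul_succ, Finset.prod_range_succ, Finset.prod_range_succ, ih,
        Finset.prod_range_succ, mul_assoc]
  set f : ℕ → ℂ := fun i => if h : i < d then ξ ⟨i, h⟩ else 1 with hf
  have hprod : ∏ j, ξ j = ∏ i ∈ Finset.range d, f i := by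
    rw [← Fin.prod_univ_eq_prod_range]
    exact Finset.prod_congr rfl fun j _ => by simp [hf]
  rw [hprod, ← hd, Finset.prod_range_add, hpair]
  obtain ⟨a, ha, ha'⟩ := hmul r₁ f fun i hi => by
    refine ⟨(ξ ⟨i, by omega⟩).re, hξ.2 _ hi, ?_⟩
    rw [hf]
    simp only [show i < d by omega, dif_pos]
    exact Complex.ext (by simp) (by simpa using hξ.1.1 ⟨i, by omega⟩ hi)
  obtain ⟨b, hb, hb'⟩ := hmul r₂ (fun i => f (r₁ + 2 * i) * f (r₁ + (2 * i + 1))) fun i hi => by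
    refine ⟨Complex.normSq (ξ ⟨r₁ + 2 * i, by omega⟩), Complex.normSq_pos.2 (h0 _), ?_⟩
    rw [hf]
    simp only [show r₁ + 2 * i < d by omega, show r₁ + (2 * i + 1) < d by omega, dif_pos]
    rw [hξ.1.2 ⟨r₁ + 2 * i, by omega⟩ ⟨r₁ + (2 * i + 1), by omega⟩ i hi rfl (by simp; omega),
      Complex.mul_conj]
  exact ⟨a * b, mul_pos ha hb, by rw [ha', hb']; push_cast; rfl⟩

section Embeddings

variable {K : Type*} [Field K] [NumberField K] {d : ℕ} (σ : Fin d ≃ (K →+* ℂ))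

include σ in
theorem nrRealPlaces_add_two_mul_nrComplexPlaces :
    NumberField.InfinitePlace.nrRealPlaces K + 2 * NumberField.InfinitePlace.nrComplexPlaces K
      = d := by
  rw [NumberField.InfinitePlace.card_add_two_mul_card_eq_rank, ← NumberField.Embeddings.card K ℂ,
    ← Fintype.card_congr σ, Fintype.card_fin]

variable (hσ : ∀ x : K, (fun j => σ j x) ∈ signatureSpace d
  (NumberField.InfinitePlace.nrRealPlaces K) (NumberField.InfinitePlace.nrComplexPlaces K))

include hσ in
theorem embeddings_mem_fieldSignaturePos {x : Kˣ} (hx : x ∈ totallyPositive K) :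
    (fun j => σ j (x : K)) ∈ fieldSignaturePos d K := by
  refine ⟨hσ x, fun j hj => ?_⟩
  have hreal : NumberField.ComplexEmbedding.IsReal (σ j) := by
    rw [NumberField.ComplexEmbedding.isReal_iff]
    ext y
    exact Complex.conj_eq_iff_im.2 ((hσ y).1 j hj)
  have := hx hreal.embedding
  rwa [← Complex.ofReal_re (hreal.embedding x),
    NumberField.ComplexEmbedding.IsReal.coe_embedding_apply] at this

include hσ in
/-- An embedding whose index is at least `r₁` belongs to a pair of distinct conjugate embeddings,
so it is not real. -/
theorem mem_totallyPositive_of_embeddings {x : Kˣ} {ξ : Fin d → ℂ}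
    (hξ : ξ ∈ fieldSignaturePos d K) (hx : ∀ j, σ j (x : K) = ξ j) : x ∈ totallyPositive K := by
  intro φ
  set j := σ.symm (Complex.ofRealHom.comp φ) with hj
  have hφ : ∀ y, σ j y = (φ y : ℂ) := fun y => by rw [hj]; simp
  by_cases hlt : j.val < NumberField.InfinitePlace.nrRealPlaces K
  · have := hξ.2 j hlt
    rwa [← hx, hφ, Complex.ofReal_re] at this
  · exfalso
    have hd := nrRealPlaces_add_two_mul_nrComplexPlaces σ
    set r₁ := NumberField.InfinitePlace.nrRealPlaces K
    set r₂ := NumberField.InfinitePlace.nrComplexPlaces K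
    have hjd := j.isLt
    rcases Nat.even_or_odd' (j.val - r₁) with ⟨k, hk | hk⟩
    · have hlt' : j.val + 1 < d := by omega
      have : σ ⟨j.val + 1, hlt'⟩ = σ j := by
        ext y
        have := (hσ y).2 j ⟨j.val + 1, hlt'⟩ k (by omega) (by omega) (by simp; omega)
        simp only [hφ, Complex.conj_ofReal] at this ⊢
        exact this
      have := congrArg Fin.val (σ.injective this)
      simp at this
    · have hlt' : j.val - 1 < d := by omega
      have : σ ⟨j.val - 1, hlt'⟩ = σ j := by
        ext y
        have := (hσ y).2 ⟨j.val - 1, hlt'⟩ j k (by omega) (by simp; omega) (by omega)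
        simp only [hφ] at this
        rw [eq_comm] at this
        rw [← Complex.conj_conj (σ ⟨j.val - 1, hlt'⟩ y), this, Complex.conj_ofReal, hφ]
      have := congrArg Fin.val (σ.injective this)
      simp at this
      omega

end Embeddings

/-! ### Matrices of cyclic shape -/

section CyclicShape

variable {n : ℕ} {A : Type*} [CommRing A]

theorem HasCyclicShape.apply_last_of_ne {M : Matrix (Fin (n + 1)) (Fin (n + 1)) A}
    (hM : HasCyclicShape M) {j : Fin (n + 1)} (hj : j ≠ Fin.last n) : M (Fin.last n) j = 0 := by
  have : j.val + 1 < n + 1 := by have := Fin.val_lt_last hj; omega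
  rw [hM _ _ this, if_neg hj.symm]

theorem HasCyclicShape.apply_zero_zero {M : Matrix (Fin (n + 1)) (Fin (n + 1)) A}
    (hM : HasCyclicShape M) (hn : n ≠ 0) : M 0 0 = 1 := by
  rw [hM 0 0 (by simp; omega), if_pos rfl]

theorem HasCyclicShape.det_eq {M : Matrix (Fin (n + 1)) (Fin (n + 1)) A}
    (hM : HasCyclicShape M) : M.det = M (Fin.last n) (Fin.last n) := by
  rw [Matrix.det_of_isUpperTriangular, Finset.prod_eq_single (Fin.last n)]
  · intro i _ hi
    have := Fin.val_lt_last hi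
    rw [hM i i (by omega), if_pos rfl]
  · simp
  · intro i j hij
    have hij : j < i := hij
    rw [hM i j (by have := i.isLt; rw [Fin.lt_def] at hij; omega), if_neg hij.ne']

/-- The matrix whose product with `M` from the left adds `v i` times the last row of `M` to row `i`;
it has determinant `1` when `v` vanishes at the last index. -/
def lastColumnTransvection (v : Fin (n + 1) → A) : Matrix (Fin (n + 1)) (Fin (n + 1)) A :=
  1 + Matrix.vecMulVec v (Pi.single (Fin.last n) 1)

theorem lastColumnTransvection_mul_apply (v : Fin (n + 1) → A)
    (M : Matrix (Fin (n + 1)) (Fin (n + 1)) A) (i j : Fin (n + 1)) :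
    (lastColumnTransvection v * M) i j = M i j + v i * M (Fin.last n) j := by
  simp [lastColumnTransvection, add_mul, Matrix.vecMulVec_mul, Matrix.vecMulVec_apply]

theorem lastColumnTransvection_mul (v w : Fin (n + 1) → A) (hw : w (Fin.last n) = 0) :
    lastColumnTransvection v * lastColumnTransvection w = lastColumnTransvection (v + w) := by
  ext i j
  rw [lastColumnTransvection_mul_apply]
  simp only [lastColumnTransvection, Matrix.add_apply, Matrix.vecMulVec_apply, hw, Pi.add_apply,
    Matrix.one_apply, Pi.single_apply, eq_comm (a := j)]
  ring

theorem hasCyclicShape_lastColumnTransvection (v : Fin (n + 1) → A) :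
    HasCyclicShape (lastColumnTransvection v) := by
  intro i j hj
  have : j ≠ Fin.last n := fun h => by simp [h] at hj
  simp [lastColumnTransvection, Matrix.vecMulVec_apply, this, Matrix.one_apply]

end CyclicShape

/-! ### The group `U` and basis matrices -/

section Unipotent

variable {n : ℕ}

theorem mem_cyclicUnipotent_iff (u : Matrix.SpecialLinearGroup (Fin (n + 1)) ℤ) :
    u ∈ cyclicUnipotent (n + 1) ↔
      ∃ v : Fin (n + 1) → ℤ, v (Fin.last n) = 0 ∧ u.val = lastColumnTransvection v := by
  constructor
  · rintro ⟨h1, h2⟩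
    refine ⟨fun i => if i = Fin.last n then 0 else u.val i (Fin.last n), by simp, ?_⟩
    ext i j
    by_cases hj : j = Fin.last n
    · subst hj
      by_cases hi : i = Fin.last n
      · subst hi
        simpa [lastColumnTransvection, Matrix.vecMulVec_apply] using h2 _
      · simp [lastColumnTransvection, Matrix.vecMulVec_apply, hi]
    · have hj' := Fin.val_lt_last hj
      rw [h1 i j (by omega), hasCyclicShape_lastColumnTransvection _ i j (by omega)]
  · rintro ⟨v, hv, hu⟩
    refine ⟨hu ▸ hasCyclicShape_lastColumnTransvection v, fun j => ?_⟩
    rw [hu]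
    by_cases hj : j = Fin.last n
    · subst hj; simp [lastColumnTransvection, Matrix.vecMulVec_apply, hv]
    · simp [lastColumnTransvection, Matrix.vecMulVec_apply, hj]

theorem exists_mem_cyclicUnipotent (v : Fin (n + 1) → ℤ) (hv : v (Fin.last n) = 0) :
    ∃ u ∈ cyclicUnipotent (n + 1), u.val = lastColumnTransvection v := by
  refine ⟨⟨lastColumnTransvection v, ?_⟩, ?_, rfl⟩
  · rw [(hasCyclicShape_lastColumnTransvection v).det_eq]
    simp [lastColumnTransvection, Matrix.vecMulVec_apply, hv]
  · exact (mem_cyclicUnipotent_iff _).2 ⟨v, hv, rfl⟩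

/-- The set `cyclicUnipotent` as a subgroup of `SL(d, ℤ)`. -/
def cyclicUnipotentSubgroup (n : ℕ) : Subgroup (Matrix.SpecialLinearGroup (Fin (n + 1)) ℤ) where
  carrier := cyclicUnipotent (n + 1)
  one_mem' := (mem_cyclicUnipotent_iff _).2 ⟨0, rfl, by simp [lastColumnTransvection]⟩
  mul_mem' := by
    intro a b ha hb
    obtain ⟨v, hv, ha⟩ := (mem_cyclicUnipotent_iff _).1 ha
    obtain ⟨w, hw, hb⟩ := (mem_cyclicUnipotent_iff _).1 hb
    refine (mem_cyclicUnipotent_iff _).2 ⟨v + w, by simp [hv, hw], ?_⟩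
    rw [Matrix.SpecialLinearGroup.coe_mul, ha, hb, lastColumnTransvection_mul v w hw]
  inv_mem' := by
    intro a ha
    obtain ⟨v, hv, ha⟩ := (mem_cyclicUnipotent_iff _).1 ha
    obtain ⟨b, hb, hb'⟩ := exists_mem_cyclicUnipotent (-v) (by simp [hv])
    have : b * a = 1 := by
      ext1
      rw [Matrix.SpecialLinearGroup.coe_mul, ha, hb', lastColumnTransvection_mul _ v hv]
      simp [lastColumnTransvection]
    rw [inv_eq_of_mul_eq_one_left this]
    exact hb

/-- Two basis matrices of the same root differ by a unipotent matrix: the classes `μ^k` fix the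
last column modulo the last row. -/
theorem CongruenceRoot.IsBasisMatrix.exists_mul_eq {F : ℤ[X]} {r : CongruenceRoot F}
    {R R' : Matrix (Fin (n + 1)) (Fin (n + 1)) ℤ} (hR : r.IsBasisMatrix R)
    (hR' : r.IsBasisMatrix R') : ∃ u ∈ cyclicUnipotentSubgroup n, u.val * R = R' := by
  have key : ∀ i : Fin (n + 1), ∃ k : ℤ, (i = Fin.last n → k = 0) ∧
      R' i (Fin.last n) = R i (Fin.last n) + k * r.modulus := by
    intro i
    by_cases hi : i = Fin.last n
    · subst hi
      exact ⟨0, fun _ => rfl, by rw [hR.2.2 _ (by simp), hR'.2.2 _ (by simp)]; simp⟩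
    · have hi' := Fin.val_lt_last hi
      have : (R i (Fin.last n) : ZMod r.modulus) = R' i (Fin.last n) := by
        rw [hR.2.1 i _ (by simp) (by omega), hR'.2.1 i _ (by simp) (by omega)]
      obtain ⟨k, hk⟩ := (ZMod.intCast_eq_intCast_iff_dvd_sub _ _ _).1 this
      exact ⟨k, fun h => absurd h hi, by rw [mul_comm, ← hk]; ring⟩
  choose v hv hv' using key
  obtain ⟨u, hu, hu'⟩ := exists_mem_cyclicUnipotent v (hv _ rfl)
  refine ⟨u, hu, ?_⟩
  ext i j
  rw [hu', lastColumnTransvection_mul_apply]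
  by_cases hj : j = Fin.last n
  · subst hj
    rw [hv' i, hR.2.2 _ (by simp)]
  · have hj' := Fin.val_lt_last hj
    rw [hR.1.apply_last_of_ne hj, hR.1 i j (by omega), hR'.1 i j (by omega)]
    simp

theorem CongruenceRoot.IsBasisMatrix.unipotent_mul {F : ℤ[X]} {r : CongruenceRoot F}
    {R : Matrix (Fin (n + 1)) (Fin (n + 1)) ℤ} (hR : r.IsBasisMatrix R)
    {u : Matrix.SpecialLinearGroup (Fin (n + 1)) ℤ} (hu : u ∈ cyclicUnipotentSubgroup n) :
    r.IsBasisMatrix (u.val * R) := by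
  obtain ⟨v, hv, hu'⟩ := (mem_cyclicUnipotent_iff _).1 hu
  have hlast : ∀ j : Fin (n + 1), j.val + 1 = n + 1 → j = Fin.last n := fun j hj =>
    Fin.ext (by simp; omega)
  refine ⟨fun i j hj => ?_, fun i j hj hi => ?_, fun j hj => ?_⟩
  · have hj' : j ≠ Fin.last n := fun h => by simp [h] at hj
    rw [hu', lastColumnTransvection_mul_apply, hR.1 i j hj, hR.1.apply_last_of_ne hj']
    simp
  · obtain rfl := hlast j hj
    rw [hu', lastColumnTransvection_mul_apply, hR.2.2 _ hj]
    push_cast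
    rw [hR.2.1 i _ hj hi]
    simp
  · obtain rfl := hlast j hj
    rw [hu', lastColumnTransvection_mul_apply, hv, hR.2.2 _ hj]
    simp

theorem CongruenceRoot.IsBasisMatrix.det_eq {F : ℤ[X]} {r : CongruenceRoot F}
    {R : Matrix (Fin (n + 1)) (Fin (n + 1)) ℤ} (hR : r.IsBasisMatrix R) :
    R.det = r.modulus := by
  rw [hR.1.det_eq, hR.2.2 _ (by simp)]

/-- For `d ≥ 2` the basis matrix shows both the modulus and, in the row of `α`, the residue. -/
theorem CongruenceRoot.eq_of_isBasisMatrix {F : ℤ[X]} (hn : n ≠ 0) {r r' : CongruenceRoot F}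
    {R : Matrix (Fin (n + 1)) (Fin (n + 1)) ℤ} (hR : r.IsBasisMatrix R)
    (hR' : r'.IsBasisMatrix R) : r = r' := by
  have hmod : r.modulus = r'.modulus := by
    have := hR.det_eq.symm.trans hR'.det_eq
    exact_mod_cast this
  have h1 := hR.2.1 ⟨n - 1, by omega⟩ (Fin.last n) (by simp) (by simp; omega)
  have h2 := hR'.2.1 ⟨n - 1, by omega⟩ (Fin.last n) (by simp) (by simp; omega)
  obtain ⟨m, hm, μ, hμ⟩ := r
  obtain ⟨m', hm', μ', hμ'⟩ := r'
  obtain rfl : m = m' := hmod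
  rw [h1] at h2
  have : n + 1 - 1 - (n - 1) = 1 := by omega
  simp only [this, pow_one, neg_inj] at h2
  subst h2
  rfl

end Unipotent

/-! ### The groups `Γ_l` -/

section Stabilizer

variable {d : ℕ}

theorem toComplex_mul (M N : Matrix (Fin d) (Fin d) ℤ) :
    toComplex (M * N) = toComplex M * toComplex N :=
  Matrix.map_mul (f := Int.castRingHom ℂ)

theorem toComplex_one : toComplex (1 : Matrix (Fin d) (Fin d) ℤ) = 1 :=
  Matrix.map_one (Int.castRingHom ℂ) (map_zero _) (map_one _)

theorem det_toComplex (M : Matrix (Fin d) (Fin d) ℤ) : (toComplex M).det = (M.det : ℂ) :=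
  ((Int.castRingHom ℂ).map_det M).symm

theorem toComplex_injective :
    Function.Injective (toComplex : Matrix (Fin d) (Fin d) ℤ → Matrix (Fin d) (Fin d) ℂ) :=
  Matrix.map_injective Int.cast_injective

theorem mem_diagonalStabilizer_iff {C : Set (Fin d → ℂ)} {B : Matrix (Fin d) (Fin d) ℂ}
    (hB : IsUnit B) (γ : Matrix.SpecialLinearGroup (Fin d) ℤ) :
    γ ∈ diagonalStabilizer C B ↔
      ∃ ξ ∈ C, toComplex γ.val * B = B * Matrix.diagonal ξ := by
  have hdet := (Matrix.isUnit_iff_isUnit_det _).1 hB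
  refine exists_congr fun ξ => and_congr_right fun _ => ⟨fun h => ?_, fun h => ?_⟩
  · rw [h, Matrix.nonsing_inv_mul_cancel_right _ _ hdet]
  · rw [← h, Matrix.mul_nonsing_inv_cancel_right _ _ hdet]

theorem ne_zero_of_mul_eq_mul_diagonal {M B : Matrix (Fin d) (Fin d) ℂ} {ξ : Fin d → ℂ}
    (hM : IsUnit M) (h : M = B * Matrix.diagonal ξ) (j : Fin d) : ξ j ≠ 0 := by
  rw [Matrix.isUnit_iff_isUnit_det, h, Matrix.det_mul, Matrix.det_diagonal, isUnit_iff_ne_zero]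
    at hM
  exact Finset.prod_ne_zero_iff.1 (right_ne_zero_of_mul hM) j (Finset.mem_univ j)

theorem isUnit_toComplex (γ : Matrix.SpecialLinearGroup (Fin d) ℤ) :
    IsUnit (toComplex γ.val) := by
  rw [Matrix.isUnit_iff_isUnit_det, det_toComplex, γ.2]
  simp

theorem diagonal_mul_diagonal_inv {ξ : Fin d → ℂ} (h : ∀ j, ξ j ≠ 0) :
    Matrix.diagonal ξ * Matrix.diagonal ξ⁻¹ = 1 := by
  rw [Matrix.diagonal_mul_diagonal, ← Matrix.diagonal_one]
  congr 1
  ext j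
  simp [h j]

/-- The stabilizer of an invertible matrix as a subgroup of `SL(d, ℤ)`. -/
def diagonalStabilizerSubgroup (r₁ r₂ : ℕ) (B : Matrix (Fin d) (Fin d) ℂ) (hB : IsUnit B) :
    Subgroup (Matrix.SpecialLinearGroup (Fin d) ℤ) where
  carrier := diagonalStabilizer (signatureSpacePos d r₁ r₂) B
  one_mem' := (mem_diagonalStabilizer_iff hB _).2
    ⟨1, one_mem_signatureSpacePos d r₁ r₂, by
      rw [Matrix.SpecialLinearGroup.coe_one, toComplex_one, Matrix.diagonal_one', one_mul, mul_one]⟩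
  mul_mem' := by
    intro a b ha hb
    obtain ⟨ξ, hξ, ha⟩ := (mem_diagonalStabilizer_iff hB _).1 ha
    obtain ⟨η, hη, hb⟩ := (mem_diagonalStabilizer_iff hB _).1 hb
    refine (mem_diagonalStabilizer_iff hB _).2 ⟨ξ * η, mul_mem_signatureSpacePos hξ hη, ?_⟩
    rw [Matrix.SpecialLinearGroup.coe_mul, toComplex_mul, mul_assoc, hb, ← mul_assoc, ha,
      mul_assoc, Matrix.diagonal_mul_diagonal]
    rfl
  inv_mem' := by
    intro a ha
    obtain ⟨ξ, hξ, ha⟩ := (mem_diagonalStabilizer_iff hB _).1 ha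
    have h0 := ne_zero_of_mul_eq_mul_diagonal ((isUnit_toComplex a).mul hB) ha
    refine (mem_diagonalStabilizer_iff hB _).2 ⟨ξ⁻¹, inv_mem_signatureSpacePos hξ, ?_⟩
    have hinv : toComplex (a⁻¹).val * toComplex a.val = 1 := by
      rw [← toComplex_mul, ← Matrix.SpecialLinearGroup.coe_mul, inv_mul_cancel,
        Matrix.SpecialLinearGroup.coe_one, toComplex_one]
    calc toComplex (a⁻¹).val * B
        = toComplex (a⁻¹).val * (B * Matrix.diagonal ξ) * Matrix.diagonal ξ⁻¹ := by
          rw [mul_assoc, mul_assoc, diagonal_mul_diagonal_inv h0, mul_one]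
      _ = B * Matrix.diagonal ξ⁻¹ := by rw [← ha, ← mul_assoc, hinv, one_mul]

end Stabilizer

/-! ### Integer combinations and embedding matrices -/

section Combination

variable {O : Type*} [CommRing O] {d : ℕ}

/-- The entries of the matrix-vector product `M b`, with `M` an integer matrix. -/
def rowCombination (M : Matrix (Fin d) (Fin d) ℤ) (b : Fin d → O) : Fin d → O :=
  fun i => ∑ j, M i j • b j

/-- The ideal `J` is the `ℤ`-span of the finite family `e`. -/
def IsIntegralSpan (J : Ideal O) (e : Fin d → O) : Prop :=
  ∀ z, z ∈ J ↔ ∃ v : Fin d → ℤ, ∑ i, v i • e i = z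

theorem sum_smul_rowCombination (v : Fin d → ℤ) (M : Matrix (Fin d) (Fin d) ℤ) (b : Fin d → O) :
    ∑ i, v i • rowCombination M b i = ∑ j, (Matrix.vecMul v M) j • b j := by
  simp only [rowCombination, Finset.smul_sum, smul_smul, Matrix.vecMul, dotProduct,
    Finset.sum_smul]
  exact Finset.sum_comm

theorem rowCombination_mul (M N : Matrix (Fin d) (Fin d) ℤ) (b : Fin d → O) :
    rowCombination (M * N) b = rowCombination M (rowCombination N b) := by
  ext i
  exact (sum_smul_rowCombination (M i) N b).symm

theorem isIntegralSpan_iff {J : Ideal O} {e : Fin d → O} :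
    IsIntegralSpan J e ↔
      Submodule.toAddSubgroup J = AddSubgroup.closure (Set.range e) := by
  rw [← Submodule.span_int_eq_addSubgroupClosure, SetLike.ext_iff]
  exact forall_congr' fun z => by
    rw [Submodule.mem_toAddSubgroup, Submodule.mem_toAddSubgroup,
      Submodule.mem_span_range_iff_exists_fun]

theorem IsIntegralSpan.mem {J : Ideal O} {e : Fin d → O} (h : IsIntegralSpan J e) (i : Fin d) :
    e i ∈ J :=
  (h _).2 ⟨Pi.single i 1, by simp [Pi.single_apply, ite_smul]⟩

theorem IsIntegralSpan.span_eq {J : Ideal O} {e : Fin d → O} (h : IsIntegralSpan J e) :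
    Ideal.span (Set.range e) = J := by
  refine le_antisymm (Ideal.span_le.2 ?_) fun z hz => ?_
  · rintro _ ⟨i, rfl⟩
    exact h.mem i
  · obtain ⟨v, rfl⟩ := (h z).1 hz
    exact Ideal.sum_mem _ fun i _ => zsmul_mem (Ideal.subset_span (Set.mem_range_self i)) _

theorem IsIntegralSpan.specialLinear {J : Ideal O} {e : Fin d → O} (h : IsIntegralSpan J e)
    (γ : Matrix.SpecialLinearGroup (Fin d) ℤ) :
    IsIntegralSpan J (rowCombination γ.val e) := by
  intro z
  rw [h z]
  constructor
  · rintro ⟨v, rfl⟩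
    refine ⟨Matrix.vecMul v γ⁻¹.val, ?_⟩
    rw [sum_smul_rowCombination, Matrix.vecMul_vecMul, ← Matrix.SpecialLinearGroup.coe_mul,
      inv_mul_cancel, Matrix.SpecialLinearGroup.coe_one, Matrix.vecMul_one]
  · rintro ⟨v, rfl⟩
    exact ⟨Matrix.vecMul v γ.val, (sum_smul_rowCombination _ _ _).symm⟩

theorem isIntegralSpan_basis {I : Ideal O} (b : Module.Basis (Fin d) ℤ I) :
    IsIntegralSpan I fun i => (b i : O) := by
  intro z
  constructor
  · intro hz
    refine ⟨fun i => b.repr ⟨z, hz⟩ i, ?_⟩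
    have := congrArg (Subtype.val : I → O) (b.sum_repr ⟨z, hz⟩)
    rw [AddSubmonoidClass.coe_finsetSum] at this
    exact this
  · rintro ⟨v, rfl⟩
    exact sum_mem fun i _ => zsmul_mem (b i).2 _

theorem span_singleton_mul_span_range {e c : Fin d → O} {a b : O}
    (h : ∀ i, b * e i = a * c i) :
    Ideal.span {b} * Ideal.span (Set.range e) = Ideal.span {a} * Ideal.span (Set.range c) := by
  rw [Ideal.span_mul_span', Ideal.span_mul_span', Set.singleton_mul, Set.singleton_mul,
    ← Set.range_comp, ← Set.range_comp]
  exact congrArg _ (congrArg _ (funext h))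

end Combination

section EmbeddingMatrix

variable {O K : Type*} [CommRing O] [Field K] [Algebra O K] {d n : ℕ}

theorem embeddingMatrix_rowCombination (σ : Fin d → (K →+* ℂ)) (M : Matrix (Fin d) (Fin d) ℤ)
    (b : Fin d → O) :
    embeddingMatrix σ (rowCombination M b) = toComplex M * embeddingMatrix σ b := by
  ext i j
  simp [embeddingMatrix, rowCombination, Matrix.mul_apply, zsmul_eq_mul]

theorem embeddingMatrix_eq_mul_diagonal_iff (σ : Fin d → (K →+* ℂ)) {e c : Fin d → O}
    {ξ : Fin d → ℂ} :
    embeddingMatrix σ e = embeddingMatrix σ c * Matrix.diagonal ξ ↔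
      ∀ i j, σ j (algebraMap O K (e i)) = σ j (algebraMap O K (c i)) * ξ j := by
  rw [← Matrix.ext_iff]
  simp [embeddingMatrix, Matrix.mul_diagonal]

/-- The embedding matrix of the powers of `a` is a Vandermonde matrix, up to the order of its
rows. -/
theorem isUnit_embeddingMatrix_pow (σ : Fin d → (K →+* ℂ)) (a : O)
    (hσ : Function.Injective fun j => σ j (algebraMap O K a)) :
    IsUnit (embeddingMatrix σ fun i : Fin d => a ^ (d - 1 - i.val)) := by
  have h : (embeddingMatrix σ fun i : Fin d => a ^ (d - 1 - i.val)) =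
      (Matrix.vandermonde fun j => σ j (algebraMap O K a)).transpose.submatrix
        Fin.revPerm (Equiv.refl _) := by
    ext i j
    simp only [embeddingMatrix, Matrix.of_apply, map_pow, Matrix.submatrix_apply,
      Matrix.transpose_apply, Matrix.vandermonde_apply, Fin.revPerm_apply, Fin.val_rev,
      Equiv.refl_apply]
    congr 1
    omega
  rw [h, Matrix.isUnit_submatrix_equiv, Matrix.isUnit_iff_isUnit_det, Matrix.det_transpose]
  exact isUnit_iff_ne_zero.2 (Matrix.det_vandermonde_ne_zero_iff.2 hσ)

theorem embedding_root_injective {F : ℤ[X]} [Algebra (AdjoinRoot F) K]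
    [IsFractionRing (AdjoinRoot F) K] :
    Function.Injective fun φ : K →+* ℂ => φ (algebraMap (AdjoinRoot F) K (AdjoinRoot.root F)) := by
  intro φ ψ h
  refine IsLocalization.ringHom_ext (AdjoinRoot F)⁰ ?_
  ext
  · simp
  · exact h

/-- If the embeddings of two families differ by a diagonal matrix, then all the ratios of
corresponding members agree. -/
theorem mul_comm_of_embeddingMatrix_eq [FaithfulSMul O K] (σ : Fin (n + 1) → (K →+* ℂ))
    {e c : Fin (n + 1) → O} {ξ : Fin (n + 1) → ℂ}
    (h : embeddingMatrix σ e = embeddingMatrix σ c * Matrix.diagonal ξ) (i k : Fin (n + 1)) :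
    c k * e i = e k * c i := by
  rw [embeddingMatrix_eq_mul_diagonal_iff] at h
  apply FaithfulSMul.algebraMap_injective O K
  apply (σ 0).injective
  simp only [map_mul, h]
  ring

/-- Multiplication by `x` acts on the embeddings as a diagonal matrix; a family in `x I` is thus an
integer combination of the generators of `I`, twisted by the conjugates of `x`. -/
theorem exists_toComplex_mul_of_eq_spanSingleton_mul [IsFractionRing O K]
    (σ : Fin d → (K →+* ℂ)) {I J : Ideal O} {e c : Fin d → O}
    (he : IsIntegralSpan J e) (hc : IsIntegralSpan I c) {x : K}
    (hx : (J : FractionalIdeal O⁰ K) = FractionalIdeal.spanSingleton O⁰ x * I) :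
    ∃ M : Matrix (Fin d) (Fin d) ℤ, embeddingMatrix σ e =
      toComplex M * embeddingMatrix σ c * Matrix.diagonal fun j => σ j x := by
  have key : ∀ i, ∃ v : Fin d → ℤ,
      algebraMap O K (e i) = x * algebraMap O K (∑ j, v j • c j) := by
    intro i
    have hi : algebraMap O K (e i) ∈ (J : FractionalIdeal O⁰ K) :=
      (FractionalIdeal.mem_coeIdeal _).2 ⟨_, he.mem i, rfl⟩
    rw [hx, FractionalIdeal.mem_singleton_mul] at hi
    obtain ⟨y, hy, hxy⟩ := hi
    obtain ⟨z, hz, rfl⟩ := (FractionalIdeal.mem_coeIdeal _).1 hy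
    obtain ⟨v, rfl⟩ := (hc z).1 hz
    exact ⟨v, hxy⟩
  choose M hM using key
  refine ⟨Matrix.of M, ?_⟩
  rw [← embeddingMatrix_rowCombination, embeddingMatrix_eq_mul_diagonal_iff]
  intro i j
  rw [hM, map_mul, mul_comm]
  rfl

end EmbeddingMatrix

/-! ### Narrow classes -/

section NarrowClass

variable {O K : Type*} [CommRing O] [Field K] [Algebra O K] [IsFractionRing O K] {n : ℕ}

theorem coeIdeal_eq_of_span_mul_eq {I J : Ideal O} {a b : O} (hb : algebraMap O K b ≠ 0) {x : K}
    (hab : algebraMap O K b * x = algebraMap O K a)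
    (h : Ideal.span {b} * J = Ideal.span {a} * I) :
    (J : FractionalIdeal O⁰ K) = FractionalIdeal.spanSingleton O⁰ x * I := by
  have := congrArg (fun L : Ideal O => (L : FractionalIdeal O⁰ K)) h
  simp only [FractionalIdeal.coeIdeal_mul, FractionalIdeal.coeIdeal_span_singleton, ← hab,
    ← FractionalIdeal.spanSingleton_mul_spanSingleton] at this
  have := congrArg (FractionalIdeal.spanSingleton O⁰ (algebraMap O K b)⁻¹ * ·) this
  simpa only [← mul_assoc, FractionalIdeal.spanSingleton_mul_spanSingleton, inv_mul_cancel₀ hb,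
    FractionalIdeal.spanSingleton_one, one_mul] using this

theorem narrowClass_eq_of_coeIdeal_eq {I J : Ideal O} {Iu Ju : (FractionalIdeal O⁰ K)ˣ}
    (hI : (Iu : FractionalIdeal O⁰ K) = I) (hJ : (Ju : FractionalIdeal O⁰ K) = J)
    {x : Kˣ} (hx : x ∈ totallyPositive K)
    (h : (J : FractionalIdeal O⁰ K) = FractionalIdeal.spanSingleton O⁰ (x : K) * I) :
    (QuotientGroup.mk Iu : NarrowClassGroup O K) = QuotientGroup.mk Ju := by
  have key : Ju = toPrincipalIdeal O K x * Iu := by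
    ext1
    rw [Units.val_mul, coe_toPrincipalIdeal, hI, hJ, h]
  rw [QuotientGroup.eq, key]
  exact ⟨x, hx, by rw [mul_comm, mul_inv_cancel_right]⟩

theorem exists_of_narrowClass_eq {I J : Ideal O} {Iu Ju : (FractionalIdeal O⁰ K)ˣ}
    (hI : (Iu : FractionalIdeal O⁰ K) = I) (hJ : (Ju : FractionalIdeal O⁰ K) = J)
    (h : (QuotientGroup.mk Iu : NarrowClassGroup O K) = QuotientGroup.mk Ju) :
    ∃ x ∈ totallyPositive K,
      (J : FractionalIdeal O⁰ K) = FractionalIdeal.spanSingleton O⁰ (x : K) * I := by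
  obtain ⟨x, hx, hxJ⟩ := QuotientGroup.eq.1 h
  refine ⟨x, hx, ?_⟩
  rw [← hI, ← hJ, ← coe_toPrincipalIdeal, ← Units.val_mul, hxJ]
  congr 1
  rw [mul_comm, mul_inv_cancel_left]

end NarrowClass

/-! ### Consequences of the matrix equation -/

section MatrixEquation

variable {O K : Type*} [CommRing O] [Field K] [Algebra O K] {d n : ℕ}

theorem rowCombination_injective {σ : Fin d → (K →+* ℂ)} {b : Fin d → O}
    (hb : IsUnit (embeddingMatrix σ b)) {M N : Matrix (Fin d) (Fin d) ℤ}
    (h : rowCombination M b = rowCombination N b) : M = N := by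
  have := congrArg (embeddingMatrix σ) h
  rw [embeddingMatrix_rowCombination, embeddingMatrix_rowCombination] at this
  exact toComplex_injective (hb.mul_left_injective this)

theorem sum_smul_injective {σ : Fin (n + 1) → (K →+* ℂ)} {b : Fin (n + 1) → O}
    (hb : IsUnit (embeddingMatrix σ b)) {v w : Fin (n + 1) → ℤ}
    (h : ∑ i, v i • b i = ∑ i, w i • b i) : v = w := by
  have : (fun _ : Fin (n + 1) => v) = fun _ => w :=
    rowCombination_injective hb (M := Matrix.of fun _ => v) (N := Matrix.of fun _ => w)
      (funext fun _ => h)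
  exact congrFun this 0

theorem rowCombination_last {R : Matrix (Fin (n + 1)) (Fin (n + 1)) ℤ} (hR : HasCyclicShape R)
    {b : Fin (n + 1) → O} (hb : b (Fin.last n) = 1) :
    rowCombination R b (Fin.last n) = (R (Fin.last n) (Fin.last n) : O) := by
  rw [rowCombination, Finset.sum_eq_single (Fin.last n)]
  · rw [hb, zsmul_one]
  · intro j _ hj
    rw [hR.apply_last_of_ne hj, zero_smul]
  · simp

theorem rowCombination_of_ne_last {R : Matrix (Fin (n + 1)) (Fin (n + 1)) ℤ}
    (hR : HasCyclicShape R) {b : Fin (n + 1) → O} (hb : b (Fin.last n) = 1) (i : Fin n) :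
    rowCombination R b i.castSucc = b i.castSucc + (R i.castSucc (Fin.last n) : O) := by
  have : ∀ j : Fin n, R i.castSucc j.castSucc = if i = j then 1 else 0 := fun j => by
    rw [hR _ _ (by simp)]
    simp
  simp [rowCombination, Fin.sum_univ_castSucc, this, hb]

/-- The ratio `x` of two families related by a diagonal matrix `ξ` lies in `K`, and `ξ` consists of
its conjugates. -/
theorem exists_units_of_embeddingMatrix_eq [FaithfulSMul O K] (σ : Fin (n + 1) → (K →+* ℂ))
    {e c : Fin (n + 1) → O} {ξ : Fin (n + 1) → ℂ}
    (h : embeddingMatrix σ e = embeddingMatrix σ c * Matrix.diagonal ξ) {i : Fin (n + 1)}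
    (hi : e i ≠ 0) :
    algebraMap O K (c i) ≠ 0 ∧ ∃ x : Kˣ,
      algebraMap O K (c i) * x = algebraMap O K (e i) ∧ ∀ j, σ j x = ξ j := by
  rw [embeddingMatrix_eq_mul_diagonal_iff] at h
  have he : algebraMap O K (e i) ≠ 0 := by
    rwa [Ne, FaithfulSMul.algebraMap_eq_zero_iff]
  have hc : algebraMap O K (c i) ≠ 0 := by
    intro h0
    have := h i 0
    rw [h0, map_zero, zero_mul, map_eq_zero] at this
    exact he this
  refine ⟨hc, Units.mk0 _ (div_ne_zero he hc), ?_, fun j => ?_⟩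
  · rw [Units.val_mk0, mul_div_cancel₀ _ hc]
  · rw [Units.val_mk0, map_div₀, h i j, mul_div_cancel_left₀]
    rwa [Ne, map_eq_zero]

theorem span_mul_eq_of_embeddingMatrix_eq [FaithfulSMul O K] (σ : Fin (n + 1) → (K →+* ℂ))
    {e c : Fin (n + 1) → O} {ξ : Fin (n + 1) → ℂ}
    (h : embeddingMatrix σ e = embeddingMatrix σ c * Matrix.diagonal ξ) (i : Fin (n + 1)) :
    Ideal.span {c i} * Ideal.span (Set.range e) = Ideal.span {e i} * Ideal.span (Set.range c) :=
  span_singleton_mul_span_range fun k => mul_comm_of_embeddingMatrix_eq σ h k i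

theorem narrowClass_eq_of_embeddingMatrix_eq [NumberField K] [IsFractionRing O K]
    (σ : Fin (n + 1) ≃ (K →+* ℂ))
    (hσ : ∀ x : K, (fun j => σ j x) ∈ signatureSpace (n + 1)
      (NumberField.InfinitePlace.nrRealPlaces K) (NumberField.InfinitePlace.nrComplexPlaces K))
    {I J : Ideal O} {e c : Fin (n + 1) → O} (he : IsIntegralSpan J e) (hc : IsIntegralSpan I c)
    {Iu Ju : (FractionalIdeal O⁰ K)ˣ} (hI : (Iu : FractionalIdeal O⁰ K) = I)
    (hJ : (Ju : FractionalIdeal O⁰ K) = J) {ξ : Fin (n + 1) → ℂ}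
    (hξ : ξ ∈ fieldSignaturePos (n + 1) K)
    (h : embeddingMatrix σ e = embeddingMatrix σ c * Matrix.diagonal ξ) {i : Fin (n + 1)}
    (hi : e i ≠ 0) :
    (QuotientGroup.mk Iu : NarrowClassGroup O K) = QuotientGroup.mk Ju := by
  obtain ⟨hc0, x, hx, hxξ⟩ := exists_units_of_embeddingMatrix_eq σ h hi
  have hspan := span_mul_eq_of_embeddingMatrix_eq σ h i
  rw [he.span_eq, hc.span_eq] at hspan
  exact narrowClass_eq_of_coeIdeal_eq hI hJ (mem_totallyPositive_of_embeddings σ hσ hξ hxξ)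
    (coeIdeal_eq_of_span_mul_eq hc0 hx hspan)

/-- A lattice in the narrow class of `I` is obtained from a basis of `I` by a matrix that is
invertible over `ℤ` and a totally positive diagonal. -/
theorem exists_embeddingMatrix_eq_of_narrowClass_eq [NumberField K] [IsFractionRing O K]
    (σ : Fin d ≃ (K →+* ℂ))
    (hσ : ∀ x : K, (fun j => σ j x) ∈ signatureSpace d
      (NumberField.InfinitePlace.nrRealPlaces K) (NumberField.InfinitePlace.nrComplexPlaces K))
    {I J : Ideal O} {e c : Fin d → O} (he : IsIntegralSpan J e) (hc : IsIntegralSpan I c)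
    (hunit : IsUnit (embeddingMatrix σ e))
    {Iu Ju : (FractionalIdeal O⁰ K)ˣ} (hI : (Iu : FractionalIdeal O⁰ K) = I)
    (hJ : (Ju : FractionalIdeal O⁰ K) = J)
    (h : (QuotientGroup.mk Iu : NarrowClassGroup O K) = QuotientGroup.mk Ju) :
    ∃ M : Matrix (Fin d) (Fin d) ℤ, IsUnit M ∧ ∃ ξ ∈ fieldSignaturePos d K,
      embeddingMatrix σ e = toComplex M * embeddingMatrix σ c * Matrix.diagonal ξ := by
  obtain ⟨x, hx, hxJ⟩ := exists_of_narrowClass_eq hI hJ h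
  have hxI : (I : FractionalIdeal O⁰ K) =
      FractionalIdeal.spanSingleton O⁰ ((x⁻¹ : Kˣ) : K) * J := by
    rw [hxJ, ← mul_assoc, FractionalIdeal.spanSingleton_mul_spanSingleton, Units.inv_mul,
      FractionalIdeal.spanSingleton_one, one_mul]
  obtain ⟨M, hM⟩ := exists_toComplex_mul_of_eq_spanSingleton_mul σ he hc hxJ
  obtain ⟨N, hN⟩ := exists_toComplex_mul_of_eq_spanSingleton_mul σ hc he hxI
  refine ⟨M, ?_, _, embeddings_mem_fieldSignaturePos σ hσ hx, hM⟩
  have hdiag : (Matrix.diagonal fun j => σ j ((x⁻¹ : Kˣ) : K)) *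
      (Matrix.diagonal fun j => σ j (x : K)) = 1 := by
    rw [Matrix.diagonal_mul_diagonal, ← Matrix.diagonal_one]
    congr 1
    ext j
    rw [← map_mul, Units.inv_mul, map_one]
  have : toComplex (M * N) * embeddingMatrix σ e = toComplex 1 * embeddingMatrix σ e := by
    rw [toComplex_one, one_mul]
    conv_rhs => rw [hM, hN]
    simp only [toComplex_mul, mul_assoc, hdiag, mul_one]
  exact IsUnit.of_mul_eq_one N (toComplex_injective (hunit.mul_left_injective this))

theorem exists_pos_det_eq {K : Type*} [Field K] [NumberField K] (σ : Fin d ≃ (K →+* ℂ))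
    {S G B B' : Matrix (Fin d) (Fin d) ℂ} {ξ : Fin d → ℂ} (hξ : ξ ∈ fieldSignaturePos d K)
    (hξ0 : ∀ j, ξ j ≠ 0) (hB : IsUnit B) (hB' : ∃ c : ℝ, 0 < c ∧ B'.det = (c : ℂ) * B.det)
    (h : S * B = G * B' * Matrix.diagonal ξ) :
    ∃ c : ℝ, 0 < c ∧ S.det = (c : ℂ) * G.det := by
  obtain ⟨c, hc, hc'⟩ := hB'
  obtain ⟨p, hp, hp'⟩ := exists_pos_prod_eq_of_mem_signatureSpacePos
    (nrRealPlaces_add_two_mul_nrComplexPlaces σ) hξ hξ0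
  refine ⟨c * p, mul_pos hc hp, ?_⟩
  have hB0 := ((Matrix.isUnit_iff_isUnit_det _).1 hB).ne_zero
  have := congrArg Matrix.det h
  rw [Matrix.det_mul, Matrix.det_mul, Matrix.det_mul, Matrix.det_diagonal, hc', hp'] at this
  apply mul_right_cancel₀ hB0
  rw [this]
  push_cast
  ring

end MatrixEquation

/-! ### Double cosets and the matrix equation -/

section DoubleCosets

variable {n r₁ r₂ : ℕ} {B B' : Matrix (Fin (n + 1)) (Fin (n + 1)) ℂ}

theorem exists_equation_of_mem_doubleCoset (hB' : IsUnit B')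
    {R : Matrix (Fin (n + 1)) (Fin (n + 1)) ℤ}
    {γ u g : Matrix.SpecialLinearGroup (Fin (n + 1)) ℤ} {ξ : Fin (n + 1) → ℂ}
    (hξ : ξ ∈ signatureSpacePos (n + 1) r₁ r₂)
    (h : toComplex R * B = toComplex γ.val * B' * Matrix.diagonal ξ)
    (hg : g ∈ diagonalStabilizerSubgroup r₁ r₂ B' hB') :
    ∃ ξ' ∈ signatureSpacePos (n + 1) r₁ r₂, toComplex (u.val * R) * B =
      toComplex (u * γ * g).val * B' * Matrix.diagonal ξ' := by
  obtain ⟨ε, hε, hgε⟩ := (mem_diagonalStabilizer_iff hB' g).1 hg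
  have h0 := ne_zero_of_mul_eq_mul_diagonal ((isUnit_toComplex g).mul hB') hgε
  refine ⟨ε⁻¹ * ξ, mul_mem_signatureSpacePos (inv_mem_signatureSpacePos hε) hξ, ?_⟩
  have hsplit : Matrix.diagonal (ε⁻¹ * ξ) = Matrix.diagonal ε⁻¹ * Matrix.diagonal ξ := by
    rw [Matrix.diagonal_mul_diagonal]
    rfl
  calc toComplex (u.val * R) * B = toComplex u.val * (toComplex γ.val * B' * Matrix.diagonal ξ) := by
        rw [toComplex_mul, mul_assoc, h]
    _ = toComplex u.val * toComplex γ.val * (B' * Matrix.diagonal ε) * Matrix.diagonal ε⁻¹ *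
          Matrix.diagonal ξ := by
        simp only [mul_assoc]
        rw [← mul_assoc (Matrix.diagonal ε), diagonal_mul_diagonal_inv h0, one_mul]
    _ = toComplex (u * γ * g).val * B' * Matrix.diagonal (ε⁻¹ * ξ) := by
        rw [← hgε, hsplit, Matrix.SpecialLinearGroup.coe_mul, Matrix.SpecialLinearGroup.coe_mul,
          toComplex_mul, toComplex_mul]
        simp only [mul_assoc]

theorem mem_doubleCoset_of_equation (hB' : IsUnit B')
    {R : Matrix (Fin (n + 1)) (Fin (n + 1)) ℤ}
    {γ γ' u : Matrix.SpecialLinearGroup (Fin (n + 1)) ℤ} {ξ ξ' : Fin (n + 1) → ℂ}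
    (hξ : ξ ∈ signatureSpacePos (n + 1) r₁ r₂) (hξ' : ξ' ∈ signatureSpacePos (n + 1) r₁ r₂)
    (h0 : ∀ j, ξ' j ≠ 0)
    (h : toComplex R * B = toComplex γ.val * B' * Matrix.diagonal ξ)
    (h' : toComplex (u.val * R) * B = toComplex γ'.val * B' * Matrix.diagonal ξ')
    (hu : u ∈ cyclicUnipotentSubgroup n) :
    γ' ∈ DoubleCoset.doubleCoset γ (cyclicUnipotentSubgroup n : Set _)
      (diagonalStabilizerSubgroup r₁ r₂ B' hB' : Set _) := by
  refine DoubleCoset.mem_doubleCoset.2 ⟨u, hu, (u * γ)⁻¹ * γ', ?_, by group⟩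
  refine (mem_diagonalStabilizer_iff hB' _).2
    ⟨ξ * ξ'⁻¹, mul_mem_signatureSpacePos hξ (inv_mem_signatureSpacePos hξ'), ?_⟩
  have hsplit : Matrix.diagonal (ξ * ξ'⁻¹) = Matrix.diagonal ξ * Matrix.diagonal ξ'⁻¹ := by
    rw [Matrix.diagonal_mul_diagonal]
    rfl
  have hγ' : toComplex γ'.val * B' =
      toComplex (u * γ).val * (B' * Matrix.diagonal (ξ * ξ'⁻¹)) := by
    calc toComplex γ'.val * B'
        = toComplex γ'.val * B' * Matrix.diagonal ξ' * Matrix.diagonal ξ'⁻¹ := by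
          rw [mul_assoc _ (Matrix.diagonal ξ'), diagonal_mul_diagonal_inv h0, mul_one]
      _ = _ := by
          rw [← h', toComplex_mul, mul_assoc _ (toComplex R), h, hsplit,
            Matrix.SpecialLinearGroup.coe_mul, toComplex_mul]
          simp only [mul_assoc]
  rw [Matrix.SpecialLinearGroup.coe_mul, toComplex_mul, mul_assoc, hγ', ← mul_assoc,
    ← toComplex_mul, ← Matrix.SpecialLinearGroup.coe_mul, inv_mul_cancel,
    Matrix.SpecialLinearGroup.coe_one, toComplex_one, one_mul]

end DoubleCosets

/-! ### Lattices of cyclic shape and roots of the congruence -/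

/-- The family `α^(d-1), …, α, 1`. -/
noncomputable def rootPowers (F : ℤ[X]) (d : ℕ) : Fin d → AdjoinRoot F :=
  fun i => AdjoinRoot.root F ^ (d - 1 - i.val)

theorem rootPowers_last (F : ℤ[X]) (n : ℕ) : rootPowers F (n + 1) (Fin.last n) = 1 := by
  simp [rootPowers]

theorem CongruenceRoot.correspondsTo_iff {F : ℤ[X]} {d : ℕ} (hd : F.natDegree = d)
    (r : CongruenceRoot F) (J : Ideal (AdjoinRoot F)) :
    r.CorrespondsTo J ↔ ∃ R : Matrix (Fin d) (Fin d) ℤ, r.IsBasisMatrix R ∧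
      IsIntegralSpan J (rowCombination R (rootPowers F d)) := by
  subst hd
  exact exists_congr fun R => and_congr_right fun _ => isIntegralSpan_iff.symm

section

variable {n : ℕ}

/-- A matrix of cyclic shape with last diagonal entry `T` is integral as soon as it divides
`T • 1` from the right. -/
theorem exists_toComplex_eq_of_mul_eq_smul_one (hn : n ≠ 0)
    {S : Matrix (Fin (n + 1)) (Fin (n + 1)) ℂ} (hS : HasCyclicShape S)
    (hT : S (Fin.last n) (Fin.last n) ≠ 0) (N : Matrix (Fin (n + 1)) (Fin (n + 1)) ℤ)
    (hN : toComplex N * S = S (Fin.last n) (Fin.last n) • (1 : Matrix _ _ ℂ)) :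
    ∃ R : Matrix (Fin (n + 1)) (Fin (n + 1)) ℤ, HasCyclicShape R ∧ toComplex R = S := by
  set T := S (Fin.last n) (Fin.last n) with hTdef
  have hcol : ∀ i (j : Fin n), (N i j.castSucc : ℂ) = if i = j.castSucc then T else 0 := by
    intro i j
    have h := congrFun (congrFun hN i) j.castSucc
    have hSj : ∀ k : Fin n, S k.castSucc j.castSucc = if k = j then 1 else 0 := fun k => by
      rw [hS _ _ (by simp)]
      simp
    rw [Matrix.mul_apply, Fin.sum_univ_castSucc,
      hS.apply_last_of_ne (Fin.castSucc_lt_last j).ne] at h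
    simpa [hSj, Matrix.one_apply] using h
  have hlast : ∀ i : Fin n, S i.castSucc (Fin.last n) = -(N i.castSucc (Fin.last n) : ℂ) := by
    intro i
    have h := congrFun (congrFun hN i.castSucc) (Fin.last n)
    rw [Matrix.mul_apply, Fin.sum_univ_castSucc, ← hTdef, Matrix.smul_apply,
      Matrix.one_apply_ne (Fin.castSucc_lt_last i).ne, smul_zero] at h
    simp only [Matrix.map_apply, hcol, Fin.castSucc_inj, ite_mul, zero_mul, Finset.sum_ite_eq,
      Finset.mem_univ, if_true] at h
    apply mul_left_cancel₀ hT
    linear_combination h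
  refine ⟨Matrix.of fun i j => if j = Fin.last n then
    (if i = Fin.last n then N 0 0 else -N i (Fin.last n)) else if i = j then 1 else 0,
    fun i j hj => ?_, ?_⟩
  · have hj' : j ≠ Fin.last n := fun h => by simp [h] at hj
    simp [hj']
  · ext i j
    refine Fin.lastCases ?_ (fun j => ?_) j
    · refine Fin.lastCases ?_ (fun i => ?_) i
      · obtain ⟨k, rfl⟩ := Nat.exists_eq_succ_of_ne_zero hn
        have := hcol 0 0
        simp only [Fin.castSucc_zero, if_true] at this
        simpa [this] using hTdef
      · simp [hlast i]
    · rw [hS i j.castSucc (by simp)]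
      by_cases hij : i = j.castSucc <;> simp [hij, (Fin.castSucc_lt_last j).ne]

/-- In the quotient by the ideal `J` of a cyclic lattice, `α` becomes the integer `μ`, minus the
entry of the basis matrix in the row of `α`; since `J ∩ ℤ = mℤ`, relations between integers that
hold modulo `J` hold modulo `m`. -/
theorem exists_congruenceRoot {F : ℤ[X]} {K : Type*} [Field K] [Algebra (AdjoinRoot F) K]
    {σ : Fin (n + 1) → (K →+* ℂ)}
    (hunit : IsUnit (embeddingMatrix σ (rootPowers F (n + 1)))) (hn : n ≠ 0)
    {R : Matrix (Fin (n + 1)) (Fin (n + 1)) ℤ} (hR : HasCyclicShape R)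
    (hpos : 0 < R (Fin.last n) (Fin.last n)) {J : Ideal (AdjoinRoot F)}
    (hJ : IsIntegralSpan J (rowCombination R (rootPowers F (n + 1)))) :
    ∃ r : CongruenceRoot F, r.IsBasisMatrix R := by
  obtain ⟨m, hm⟩ := Int.eq_ofNat_of_zero_le hpos.le
  have hm0 : 0 < m := by omega
  have hJZ : ∀ k : ℤ, (k : AdjoinRoot F) ∈ J → (m : ℤ) ∣ k := by
    intro k hk
    obtain ⟨v, hv⟩ := (hJ _).1 hk
    rw [sum_smul_rowCombination] at hv
    have hk' : ∑ j, (Pi.single (Fin.last n) k : Fin (n + 1) → ℤ) j • rootPowers F (n + 1) j =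
        (k : AdjoinRoot F) := by
      simp [Pi.single_apply, ite_smul, rootPowers_last]
    have hvec := sum_smul_injective hunit (hv.trans hk'.symm)
    have hv0 : ∀ j : Fin n, v j.castSucc = 0 := by
      intro j
      have h := congrFun hvec j.castSucc
      have hRj : ∀ k : Fin n, R k.castSucc j.castSucc = if k = j then 1 else 0 := fun k => by
        rw [hR _ _ (by simp)]
        simp
      rw [Matrix.vecMul, dotProduct, Fin.sum_univ_castSucc,
        hR.apply_last_of_ne (Fin.castSucc_lt_last j).ne] at h
      simpa [hRj] using h
    have h := congrFun hvec (Fin.last n)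
    rw [Matrix.vecMul, dotProduct, Fin.sum_univ_castSucc, hm, Pi.single_eq_same] at h
    simp only [hv0, zero_mul, Finset.sum_const_zero, zero_add] at h
    exact ⟨v (Fin.last n), by rw [← h, mul_comm]⟩
  set α := AdjoinRoot.root F
  have hmem : ∀ i : Fin n,
      α ^ (n - i.val) + (R i.castSucc (Fin.last n) : AdjoinRoot F) ∈ J := fun i => by
    have := hJ.mem i.castSucc
    rw [rowCombination_of_ne_last hR (rootPowers_last F n)] at this
    simpa [rootPowers] using this
  obtain ⟨μ, hμ⟩ : ∃ μ : ℤ, α - (μ : AdjoinRoot F) ∈ J := by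
    refine ⟨-R (Fin.castSucc ⟨n - 1, by omega⟩) (Fin.last n), ?_⟩
    have := hmem ⟨n - 1, by omega⟩
    rw [show n - (n - 1) = 1 by omega, pow_one] at this
    simpa using this
  have heval : ((F.eval μ : ℤ) : ZMod m) = 0 := by
    rw [ZMod.intCast_zmod_eq_zero_iff_dvd]
    refine hJZ _ ?_
    have hα : (F.map (Int.castRingHom (AdjoinRoot F))).eval α = 0 := by
      rw [eval_map, ← AdjoinRoot.eval₂_root F]
      congr 1
    have hdvd := J.mem_of_dvd
      (sub_dvd_eval_sub α (μ : AdjoinRoot F) (F.map (Int.castRingHom (AdjoinRoot F)))) hμ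
    rw [hα, zero_sub, neg_mem_iff, eval_map, ← eq_intCast (Int.castRingHom (AdjoinRoot F)) μ,
      eval₂_at_apply] at hdvd
    exact hdvd
  refine ⟨⟨m, hm0, (μ : ZMod m), ?_⟩, hR, fun i j hj hi => ?_, fun j hj => ?_⟩
  · rw [← eq_intCast (Int.castRingHom (ZMod m)) μ, eval₂_at_apply]
    exact heval
  · obtain rfl : j = Fin.last n := Fin.ext (by simp; omega)
    obtain ⟨i, rfl⟩ : ∃ k : Fin n, i = k.castSucc := ⟨⟨i.val, by omega⟩, rfl⟩
    have h1 := J.mem_of_dvd (sub_dvd_pow_sub_pow α (μ : AdjoinRoot F) (n - i.val)) hμ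
    have h2 := hJZ (R i.castSucc (Fin.last n) + μ ^ (n - i.val)) (by
      have := J.sub_mem (hmem i) h1
      push_cast
      convert this using 1
      ring)
    rw [← ZMod.intCast_zmod_eq_zero_iff_dvd] at h2
    push_cast at h2
    rw [eq_neg_iff_add_eq_zero]
    simpa using h2
  · obtain rfl : j = Fin.last n := Fin.ext (by simp; omega)
    exact hm

/-- The last row of an equation of cyclic shape reads `c_last^(j) ξ^(j) = T` for all `j`, so that one
vanishing `ξ^(j)` would make all of them vanish. -/
theorem ne_zero_of_equation {O K : Type*} [CommRing O] [Field K] [Algebra O K] [FaithfulSMul O K]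
    {σ : Fin (n + 1) → (K →+* ℂ)} (hn : n ≠ 0) {b c : Fin (n + 1) → O} (hb : b (Fin.last n) = 1)
    (hunit : IsUnit (embeddingMatrix σ b)) (hc : IsUnit (embeddingMatrix σ c))
    {S : Matrix (Fin (n + 1)) (Fin (n + 1)) ℂ} (hS : HasCyclicShape S) {ξ : Fin (n + 1) → ℂ}
    (h : embeddingMatrix σ c * Matrix.diagonal ξ = S * embeddingMatrix σ b) (j : Fin (n + 1)) :
    ξ j ≠ 0 := by
  have hrow : ∀ j, σ j (algebraMap O K (c (Fin.last n))) * ξ j =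
      S (Fin.last n) (Fin.last n) := by
    intro j
    have := congrFun (congrFun h (Fin.last n)) j
    rw [Matrix.mul_diagonal, Matrix.mul_apply, Finset.sum_eq_single (Fin.last n)] at this
    · simpa [embeddingMatrix, hb] using this
    · intro k _ hk
      rw [hS.apply_last_of_ne hk, zero_mul]
    · simp
  have hclast : algebraMap O K (c (Fin.last n)) ≠ 0 := by
    intro h0
    refine ((Matrix.isUnit_iff_isUnit_det _).1 hc).ne_zero
      (Matrix.det_eq_zero_of_row_eq_zero (Fin.last n) fun k => ?_)
    simp [embeddingMatrix, h0]
  intro hj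
  have hξ : ξ = 0 := by
    ext k
    have := hrow k
    rw [← hrow j, hj, mul_zero, mul_eq_zero, map_eq_zero] at this
    exact this.resolve_left hclast
  have hS0 : S = 0 := by
    apply hunit.mul_left_injective
    change S * _ = 0 * _
    rw [← h, hξ, Matrix.diagonal_zero', mul_zero, zero_mul]
  have := hS.apply_zero_zero hn
  simp [hS0] at this

/-- An equation of cyclic shape forces integrality. With `T` the corner entry and `c` the given
basis of `I`, one has `T α^k = N (S α^•)`, where the integer matrix `N` expresses `α^k c_last ∈ I`
through `c`; hence `N S = T`. -/
theorem exists_root_of_equation {F : ℤ[X]} {K : Type*} [Field K] [NumberField K]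
    [Algebra (AdjoinRoot F) K] [IsFractionRing (AdjoinRoot F) K] [IsDomain (AdjoinRoot F)]
    (hd : F.natDegree = n + 1) {σ : Fin (n + 1) → (K →+* ℂ)}
    (hunit : IsUnit (embeddingMatrix σ (rootPowers F (n + 1)))) (hn : n ≠ 0)
    {I : Ideal (AdjoinRoot F)} {c : Fin (n + 1) → AdjoinRoot F} (hc : IsIntegralSpan I c)
    {Iu : (FractionalIdeal (AdjoinRoot F)⁰ K)ˣ}
    (hI : (Iu : FractionalIdeal (AdjoinRoot F)⁰ K) = I)
    {S : Matrix (Fin (n + 1)) (Fin (n + 1)) ℂ} (hS : HasCyclicShape S)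
    (hdet : ∃ t : ℝ, 0 < t ∧ S.det = t) {ξ : Fin (n + 1) → ℂ}
    (h : embeddingMatrix σ c * Matrix.diagonal ξ =
      S * embeddingMatrix σ (rootPowers F (n + 1))) :
    ∃ r : CongruenceRoot F, r.HasInvertibleIdeal K ∧
      ∃ R : Matrix (Fin (n + 1)) (Fin (n + 1)) ℤ, r.IsBasisMatrix R ∧ toComplex R = S := by
  obtain ⟨t, ht, hdet⟩ := hdet
  rw [hS.det_eq] at hdet
  have ht0 : (t : ℂ) ≠ 0 := by exact_mod_cast ht.ne'
  have hclast : ∀ j, σ j (algebraMap (AdjoinRoot F) K (c (Fin.last n))) * ξ j = t := by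
    intro j
    have := congrFun (congrFun h (Fin.last n)) j
    rw [Matrix.mul_diagonal, Matrix.mul_apply, Finset.sum_eq_single (Fin.last n), hdet] at this
    · simpa [embeddingMatrix, rootPowers_last] using this
    · intro k _ hk
      rw [hS.apply_last_of_ne hk, zero_mul]
    · simp
  obtain ⟨N, hN⟩ : ∃ N : Matrix (Fin (n + 1)) (Fin (n + 1)) ℤ,
      rowCombination N c = fun k => rootPowers F (n + 1) k * c (Fin.last n) := by
    have : ∀ k, ∃ v : Fin (n + 1) → ℤ,
        ∑ i, v i • c i = rootPowers F (n + 1) k * c (Fin.last n) := fun k =>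
      (hc _).1 (I.mul_mem_left _ (hc.mem _))
    choose v hv using this
    exact ⟨Matrix.of v, funext hv⟩
  have hNS : toComplex N * S = (t : ℂ) • 1 := by
    apply hunit.mul_left_injective
    change toComplex N * S * _ = (t : ℂ) • 1 * _
    rw [mul_assoc, ← h, ← mul_assoc, ← embeddingMatrix_rowCombination, hN, smul_mul_assoc,
      one_mul]
    ext k j
    rw [Matrix.mul_diagonal]
    simp only [embeddingMatrix, Matrix.of_apply, map_mul, Matrix.smul_apply, smul_eq_mul]
    rw [mul_assoc, hclast, mul_comm]
  obtain ⟨R, hR, rfl⟩ := exists_toComplex_eq_of_mul_eq_smul_one hn hS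
    (by rw [hdet]; exact ht0) N (by rw [hdet]; exact hNS)
  have hRpos : 0 < R (Fin.last n) (Fin.last n) := by
    have : (R (Fin.last n) (Fin.last n) : ℝ) = t := by
      have hdet' : ((R (Fin.last n) (Fin.last n) : ℤ) : ℂ) = t := hdet
      exact_mod_cast hdet'
    exact_mod_cast this ▸ ht
  have h' := h.symm
  rw [← embeddingMatrix_rowCombination] at h'
  set e := rowCombination R (rootPowers F (n + 1)) with he_def
  have helast : e (Fin.last n) = (R (Fin.last n) (Fin.last n) : AdjoinRoot F) :=
    rowCombination_last hR (rootPowers_last F n)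
  have hc0 : c (Fin.last n) ≠ 0 := by
    intro h0
    have := hclast 0
    rw [h0, map_zero, map_zero, zero_mul] at this
    exact ht0 this.symm
  have he0 : e (Fin.last n) ≠ 0 := by
    intro h0
    have h1 := (embeddingMatrix_eq_mul_diagonal_iff σ).1 h' (Fin.last n) 0
    rw [hclast, h0, map_zero, map_zero] at h1
    exact ht0 h1.symm
  have hspan := span_mul_eq_of_embeddingMatrix_eq σ h' (Fin.last n)
  rw [hc.span_eq] at hspan
  have hJ : IsIntegralSpan (Ideal.span (Set.range e)) e := by
    intro z
    constructor
    · intro hz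
      have : c (Fin.last n) * z ∈ Ideal.span {c (Fin.last n)} * Ideal.span (Set.range e) :=
        Ideal.mul_mem_mul (Ideal.mem_span_singleton_self _) hz
      rw [hspan, Ideal.mem_span_singleton_mul] at this
      obtain ⟨w, hw, hwz⟩ := this
      obtain ⟨v, rfl⟩ := (hc w).1 hw
      refine ⟨v, mul_left_cancel₀ hc0 ?_⟩
      rw [← hwz, Finset.mul_sum, Finset.mul_sum]
      refine Finset.sum_congr rfl fun i _ => ?_
      rw [mul_smul_comm, mul_smul_comm, mul_comm_of_embeddingMatrix_eq σ h']
    · rintro ⟨v, rfl⟩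
      exact sum_mem fun i _ => zsmul_mem (Ideal.subset_span (Set.mem_range_self i)) _
  obtain ⟨r, hr⟩ := exists_congruenceRoot hunit hn hR hRpos hJ
  refine ⟨r, ⟨_, (r.correspondsTo_iff hd _).2 ⟨R, hr, hJ⟩, ?_⟩, R, hr, rfl⟩
  obtain ⟨hcK, x, hx, -⟩ := exists_units_of_embeddingMatrix_eq σ h' he0
  refine ⟨toPrincipalIdeal (AdjoinRoot F) K x * Iu, ?_⟩
  rw [coeIdeal_eq_of_span_mul_eq hcK hx hspan, Units.val_mul, coe_toPrincipalIdeal, hI]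

/-- For `d ≥ 2`, two cyclic integer matrices whose lattices differ by a diagonal matrix are equal:
the last rows show that the diagonal matrix is scalar, and the corner entry `1` that the scalar
is `1`. -/
theorem eq_of_mul_diagonal {O K : Type*} [CommRing O] [Field K] [Algebra O K] [FaithfulSMul O K]
    {σ : Fin (n + 1) → (K →+* ℂ)} (hn : n ≠ 0) {b : Fin (n + 1) → O} (hb : b (Fin.last n) = 1)
    (hunit : IsUnit (embeddingMatrix σ b)) {R R' : Matrix (Fin (n + 1)) (Fin (n + 1)) ℤ}
    (hR : HasCyclicShape R) (hR' : HasCyclicShape R') (h0 : R (Fin.last n) (Fin.last n) ≠ 0)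
    {η : Fin (n + 1) → ℂ}
    (h : toComplex R' * embeddingMatrix σ b = toComplex R * embeddingMatrix σ b *
      Matrix.diagonal η) : R' = R := by
  rw [← embeddingMatrix_rowCombination, ← embeddingMatrix_rowCombination] at h
  have key : R (Fin.last n) (Fin.last n) • R' = R' (Fin.last n) (Fin.last n) • R := by
    apply rowCombination_injective hunit
    ext i
    have := mul_comm_of_embeddingMatrix_eq σ h i (Fin.last n)
    rw [rowCombination_last hR hb, rowCombination_last hR' hb, ← zsmul_eq_mul,
      ← zsmul_eq_mul] at this
    simpa [rowCombination, Finset.smul_sum, Finset.mul_sum, mul_assoc] using this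
  have h1 := congrFun (congrFun key 0) 0
  simp only [Matrix.smul_apply, hR.apply_zero_zero hn, hR'.apply_zero_zero hn, smul_eq_mul,
    mul_one] at h1
  rw [← h1] at key
  exact smul_right_injective _ h0 key

end

/-! ### The bijection between roots and double cosets -/

theorem theorem1p4
    (F : ℤ[X]) (hmonic : F.Monic) (hirr : Irreducible F) (d : ℕ) (hd : F.natDegree = d)
    -- `K = ℚ(α)` is the field of fractions of `ℤ[α] = ℤ[X]/(F)`
    (K : Type*) [Field K] [NumberField K] [Algebra (AdjoinRoot F) K]
    [IsFractionRing (AdjoinRoot F) K]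
    -- the `d` complex embeddings, the real ones first, then the pairs of conjugate ones
    (σ : Fin d ≃ (K →+* ℂ))
    (hσ : ∀ x : K, (fun j => σ j x) ∈ signatureSpace d
      (NumberField.InfinitePlace.nrRealPlaces K) (NumberField.InfinitePlace.nrComplexPlaces K))
    -- integral representatives `I l` of the narrow ideal classes `l`
    (I : NarrowClassGroup (AdjoinRoot F) K → Ideal (AdjoinRoot F))
    (hI : ∀ l, ∃ J : (FractionalIdeal (AdjoinRoot F)⁰ K)ˣ,
      (J : FractionalIdeal (AdjoinRoot F)⁰ K) = (I l : FractionalIdeal (AdjoinRoot F)⁰ K) ∧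
        (QuotientGroup.mk J : NarrowClassGroup (AdjoinRoot F) K) = l)
    -- a `ℤ`-basis of each `I l`, and the matrix `𝔅 l` of its embeddings
    (β : ∀ l, Module.Basis (Fin d) ℤ (I l))
    (𝔅 : NarrowClassGroup (AdjoinRoot F) K → Matrix (Fin d) (Fin d) ℂ)
    (h𝔅 : ∀ l, 𝔅 l = embeddingMatrix σ fun i => (β l i : AdjoinRoot F))
    -- the principal narrow class is represented by `ℤ[α]` with the basis `α^(d-1), …, α, 1`
    (hI_one : I 1 = ⊤)
    (hβ_one : ∀ i, (β 1 i : AdjoinRoot F) = AdjoinRoot.root F ^ (d - 1 - i.val))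
    -- all `det 𝔅 l` have the same sign
    (hsign : ∀ l, ∃ c : ℝ, 0 < c ∧ (𝔅 l).det = (c : ℂ) * (𝔅 1).det) :
    -- each root with an invertible ideal gives a unique `l` and a unique double coset
    (∀ r : CongruenceRoot F, r.HasInvertibleIdeal K →
      ∃ l, ∃ D ∈ cyclicDoubleCosets (diagonalStabilizer (fieldSignaturePos d K) (𝔅 l)),
        (∀ R : Matrix (Fin d) (Fin d) ℤ, r.IsBasisMatrix R →
          ∃ γ ∈ D, ∃ ξ ∈ fieldSignaturePos d K,
            toComplex R * 𝔅 1 = toComplex γ.val * 𝔅 l * Matrix.diagonal ξ) ∧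
        (∀ γ ∈ D, ∃ R : Matrix (Fin d) (Fin d) ℤ, r.IsBasisMatrix R ∧
          ∃ ξ ∈ fieldSignaturePos d K,
            toComplex R * 𝔅 1 = toComplex γ.val * 𝔅 l * Matrix.diagonal ξ) ∧
        (∀ l', ∀ D' ∈ cyclicDoubleCosets (diagonalStabilizer (fieldSignaturePos d K) (𝔅 l')),
          (∃ γ ∈ D', ∃ R : Matrix (Fin d) (Fin d) ℤ, r.IsBasisMatrix R ∧
            ∃ ξ ∈ fieldSignaturePos d K,
              toComplex R * 𝔅 1 = toComplex γ.val * 𝔅 l' * Matrix.diagonal ξ) →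
          l' = l ∧ D' = D)) ∧
    -- conversely, a double coset with a solution of the weaker equation comes from a unique root
    (2 ≤ d →
      ∀ l, ∀ D ∈ cyclicDoubleCosets (diagonalStabilizer (fieldSignaturePos d K) (𝔅 l)),
        ∀ γ ∈ D, ∀ ξ ∈ fieldSignaturePos d K, ∀ S : Matrix (Fin d) (Fin d) ℂ, HasCyclicShape S →
          toComplex γ.val * 𝔅 l * Matrix.diagonal ξ = S * 𝔅 1 →
          ∃ r : CongruenceRoot F, r.HasInvertibleIdeal K ∧
            (∃ R : Matrix (Fin d) (Fin d) ℤ, r.IsBasisMatrix R ∧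
              toComplex γ.val * 𝔅 l * Matrix.diagonal ξ = toComplex R * 𝔅 1) ∧
            (∀ r' : CongruenceRoot F,
              (∃ γ' ∈ D, ∃ ξ' ∈ fieldSignaturePos d K, ∃ R' : Matrix (Fin d) (Fin d) ℤ,
                r'.IsBasisMatrix R' ∧
                toComplex γ'.val * 𝔅 l * Matrix.diagonal ξ' = toComplex R' * 𝔅 1) →
              r' = r)) := by
  have : IsDomain (AdjoinRoot F) := AdjoinRoot.isDomain_of_prime hirr.prime
  obtain ⟨n, rfl⟩ : ∃ n, d = n + 1 := by
    refine Nat.exists_eq_succ_of_ne_zero fun h0 => ?_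
    rw [h0, hmonic.natDegree_eq_zero] at hd
    exact hirr.not_isUnit (hd ▸ isUnit_one)
  -- `𝔅 1` is invertible, hence so is every `𝔅 l`
  have h𝔅_one : 𝔅 1 = embeddingMatrix σ (rootPowers F (n + 1)) := by
    rw [h𝔅]
    exact congrArg _ (funext hβ_one)
  have hunit_one : IsUnit (embeddingMatrix σ (rootPowers F (n + 1))) :=
    isUnit_embeddingMatrix_pow σ _ fun i j h => σ.injective (embedding_root_injective h)
  have hunit : ∀ l, IsUnit (𝔅 l) := by
    intro l
    obtain ⟨c, hc, hc'⟩ := hsign l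
    rw [Matrix.isUnit_iff_isUnit_det, hc', h𝔅_one]
    exact IsUnit.mul (by simp [hc.ne']) ((Matrix.isUnit_iff_isUnit_det _).1 hunit_one)
  have hβ : ∀ l, IsIntegralSpan (I l) fun i => (β l i : AdjoinRoot F) :=
    fun l => isIntegralSpan_basis (β l)
  have hR𝔅 : ∀ (r : CongruenceRoot F) (R : Matrix (Fin (n + 1)) (Fin (n + 1)) ℤ),
      r.IsBasisMatrix R → IsUnit (toComplex R * 𝔅 1) := by
    intro r R hR
    refine IsUnit.mul ?_ (hunit 1)
    rw [Matrix.isUnit_iff_isUnit_det, det_toComplex, hR.det_eq, isUnit_iff_ne_zero]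
    exact_mod_cast r.modulus_pos.ne'
  have hξ0 : ∀ (r : CongruenceRoot F) (R : Matrix (Fin (n + 1)) (Fin (n + 1)) ℤ) l
      (γ : Matrix.SpecialLinearGroup (Fin (n + 1)) ℤ) (ξ : Fin (n + 1) → ℂ), r.IsBasisMatrix R →
      toComplex R * 𝔅 1 = toComplex γ.val * 𝔅 l * Matrix.diagonal ξ → ∀ j, ξ j ≠ 0 :=
    fun r R l γ ξ hR h => ne_zero_of_mul_eq_mul_diagonal (hR𝔅 r R hR) h
  constructor
  · rintro r ⟨J, hJ, Ju, hJu⟩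
    obtain ⟨R, hR, hspan⟩ := (r.correspondsTo_iff hd J).1 hJ
    obtain ⟨l, hl⟩ : ∃ l : NarrowClassGroup (AdjoinRoot F) K, l = QuotientGroup.mk Ju := ⟨_, rfl⟩
    obtain ⟨Iu, hIu, hIl⟩ := hI l
    have hspan' : embeddingMatrix σ (rowCombination R (rootPowers F (n + 1))) =
        toComplex R * 𝔅 1 := by
      rw [embeddingMatrix_rowCombination, h𝔅_one]
    obtain ⟨M, hM, ξ, hξ, hMξ⟩ := exists_embeddingMatrix_eq_of_narrowClass_eq σ hσ hspan (hβ l)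
      (hspan' ▸ hR𝔅 r R hR) hIu hJu (hIl.trans hl)
    rw [hspan', ← h𝔅] at hMξ
    -- the signs of the determinants exclude `det M = -1`
    have hdet : M.det = 1 := by
      obtain ⟨c, hc, hc'⟩ := exists_pos_det_eq σ hξ
        (ne_zero_of_mul_eq_mul_diagonal (hR𝔅 r R hR) hMξ) (hunit 1) (hsign l) hMξ
      rw [det_toComplex, det_toComplex, hR.det_eq, Int.cast_natCast] at hc'
      have hc'' : (r.modulus : ℝ) = c * (M.det : ℤ) := by
        apply Complex.ofReal_injective
        simpa only [Complex.ofReal_mul, Complex.ofReal_natCast, Complex.ofReal_intCast] using hc'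
      have hmpos : (0 : ℝ) < r.modulus := by exact_mod_cast r.modulus_pos
      rw [hc''] at hmpos
      have hpos : 0 < M.det := by exact_mod_cast pos_of_mul_pos_right hmpos hc.le
      rcases Int.isUnit_iff.1 ((Matrix.isUnit_iff_isUnit_det M).1 hM) with h | h
      · exact h
      · omega
    set γ : Matrix.SpecialLinearGroup (Fin (n + 1)) ℤ := ⟨M, hdet⟩
    have hγ : toComplex R * 𝔅 1 = toComplex γ.val * 𝔅 l * Matrix.diagonal ξ := hMξ
    refine ⟨l, _, ⟨γ, rfl⟩, fun R' hR' => ?_, fun γ' hγ' => ?_, ?_⟩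
    · obtain ⟨u, hu, rfl⟩ := hR.exists_mul_eq hR'
      refine ⟨u * γ, DoubleCoset.mem_doubleCoset.2 ⟨u, hu, 1,
        (diagonalStabilizerSubgroup _ _ _ (hunit l)).one_mem, by simp⟩, ξ, hξ, ?_⟩
      rw [toComplex_mul, mul_assoc, hγ, Matrix.SpecialLinearGroup.coe_mul, toComplex_mul]
      simp only [mul_assoc]
    · obtain ⟨u, hu, g, hg, rfl⟩ := DoubleCoset.mem_doubleCoset.1 hγ'
      exact ⟨u.val * R, hR.unipotent_mul hu,
        exists_equation_of_mem_doubleCoset (hunit l) hξ hγ hg⟩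
    · rintro l' _ ⟨γ₀, rfl⟩ ⟨γ', hγ', R', hR', ξ', hξ', h'⟩
      obtain ⟨u, hu, rfl⟩ := hR.exists_mul_eq hR'
      have hll : l' = l := by
        obtain ⟨Iu', hIu', hIl'⟩ := hI l'
        have hJ' : IsIntegralSpan J (rowCombination (u.val * R) (rootPowers F (n + 1))) := by
          rw [rowCombination_mul]
          exact hspan.specialLinear u
        have hlast : rowCombination (u.val * R) (rootPowers F (n + 1)) (Fin.last n) ≠ 0 := by
          rw [rowCombination_last hR'.1 (rootPowers_last F n), hR'.2.2 _ (by simp)]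
          intro h0
          have := congrArg (algebraMap (AdjoinRoot F) K) h0
          rw [Int.cast_natCast, map_natCast, map_zero, Nat.cast_eq_zero] at this
          exact r.modulus_pos.ne' this
        rw [h𝔅_one, ← embeddingMatrix_rowCombination, h𝔅 l', ← embeddingMatrix_rowCombination]
          at h'
        rw [hl, ← hIl']
        exact narrowClass_eq_of_embeddingMatrix_eq σ hσ hJ' ((hβ l').specialLinear γ') hIu' hJu
          hξ' h' hlast
      subst hll
      refine ⟨rfl, ?_⟩
      have hmem := mem_doubleCoset_of_equation (hunit l') hξ hξ' (hξ0 r _ l' γ' ξ' hR' h') hγ h' hu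
      exact (DoubleCoset.doubleCoset_eq_of_mem (H := cyclicUnipotentSubgroup n)
        (K := diagonalStabilizerSubgroup _ _ _ (hunit l')) hγ').symm.trans
          (DoubleCoset.doubleCoset_eq_of_mem hmem)
  · rintro hd2 l _ ⟨γ₀, rfl⟩ γ hγD ξ hξ S hS h
    have hn : n ≠ 0 := by omega
    obtain ⟨Iu, hIu, -⟩ := hI l
    have h' := h
    rw [h𝔅_one, h𝔅 l, ← embeddingMatrix_rowCombination] at h'
    have h0 : ∀ j, ξ j ≠ 0 := by
      refine ne_zero_of_equation hn (rootPowers_last F n) hunit_one ?_ hS h'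
      rw [embeddingMatrix_rowCombination, ← h𝔅]
      exact (isUnit_toComplex γ).mul (hunit l)
    have hdet : ∃ t : ℝ, 0 < t ∧ S.det = t := by
      obtain ⟨c, hc, hc'⟩ := exists_pos_det_eq σ hξ h0 (hunit 1) (hsign l) h.symm
      exact ⟨c, hc, by rw [hc', det_toComplex, γ.2]; simp⟩
    obtain ⟨r, hr, R, hR, rfl⟩ := exists_root_of_equation hd hunit_one hn
      ((hβ l).specialLinear γ) hIu hS hdet h'
    refine ⟨r, hr, ⟨R, hR, h⟩, ?_⟩
    rintro r' ⟨γ', hγ', ξ', hξ', R', hR', h''⟩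
    -- `γ` lies in the double coset of `γ'`, so that `r'` has a basis matrix that belongs to `γ`
    have hmem : γ ∈ DoubleCoset.doubleCoset γ' (cyclicUnipotentSubgroup n : Set _)
        (diagonalStabilizerSubgroup (NumberField.InfinitePlace.nrRealPlaces K)
          (NumberField.InfinitePlace.nrComplexPlaces K) _ (hunit l) : Set _) := by
      rw [DoubleCoset.doubleCoset_eq_of_mem (H := cyclicUnipotentSubgroup n)
        (K := diagonalStabilizerSubgroup _ _ _ (hunit l)) hγ']
      exact hγD
    obtain ⟨u, hu, g, hg, rfl⟩ := DoubleCoset.mem_doubleCoset.1 hmem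
    obtain ⟨η, -, hη⟩ :=
      exists_equation_of_mem_doubleCoset (u := u) (hunit l) hξ' h''.symm hg
    have huR' := hR'.unipotent_mul hu
    have hη' : toComplex (u.val * R') * 𝔅 1 =
        toComplex R * 𝔅 1 * Matrix.diagonal (ξ⁻¹ * η) := by
      have hsplit : Matrix.diagonal (ξ⁻¹ * η) = Matrix.diagonal ξ⁻¹ * Matrix.diagonal η := by
        rw [Matrix.diagonal_mul_diagonal]
        rfl
      rw [← h, hsplit, hη, mul_assoc _ (Matrix.diagonal ξ), ← mul_assoc (Matrix.diagonal ξ),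
        diagonal_mul_diagonal_inv h0, one_mul]
    rw [h𝔅_one] at hη'
    have hRR := eq_of_mul_diagonal hn (rootPowers_last F n) hunit_one hR.1 huR'.1
      (by rw [hR.2.2 _ (by simp)]; exact_mod_cast r.modulus_pos.ne') hη'
    exact CongruenceRoot.eq_of_isBasisMatrix hn (hRR ▸ huR') hR
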